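/- A \emph{skew-torsion Lorentzian three-manifold} is a tuple $(M,g,u,\mathfrak{f})$ where $(M,g)$ is a smooth oriented Lorentzian three-manifold of signature $(2,1)$, with volume form $\nu_g$, that is strongly spin (it carries a $\mathrm{Spin}_0(2,1)$-structure), $u\in\Omega^1(M)$ is an isotropic (nowhere vanishing, null) one-form, and $\mathfrak{f}\in C^\infty(M)$ is a function such that $\nabla^g u=\mathfrak{f}\ast_g u$. Here $\nabla^g$ is the Levi-Civita connection and $\ast_g u=u\lrcorner_g\nu_g$. We write $\alpha\odot\beta=\alpha\otimes\beta+\beta\otimes\alpha$. For smooth functions $\mathfrak{f},\mathcal{H}$ of $(x_u,z)\in\mathbb{R}^2$ and a smooth function $c$ of $x_u\in\mathbb{R}$, set $\mathcal{F}(x_u,z)=2\int_0^z\mathfrak{f}(x_u,s)\,ds+c(x_u)$ and $$g_{\mathfrak{f},\mathcal{H},c}=\mathcal{H}(x_u,z)\,dx_u\otimes dx_u+e^{\mathcal{F}(x_u,z)}\,dx_u\odot dx_v+dz\otimes dz .$$ \textbf{Proposition.} (1) Let $(M,g,u,\mathfrak{f})$ be a skew-torsion Lorentzian three-manifold. Around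 every point of $M$ there are local coordinates $(x_u,x_v,z)$ in which $\mathfrak{f}$ depends only on $(x_u,z)$ and $$g=\mathcal{H}\,dx_u\otimes dx_u+e^{2\int\mathfrak{f}\,dz+c(x_u)}\,dx_u\odot dx_v+dz\otimes dz,\qquad u=e^{2\int\mathfrak{f}\,dz+c(x_u)}\,dx_u,$$ for a function $\mathcal{H}$ of $(x_u,z)$ and a function $c$ of $x_u$ only. More precisely, there are smooth functions $\hat{\mathfrak{f}},\mathcal{H}$ on $\mathbb{R}^2$ and $c$ on $\mathbb{R}$ such that, on the coordinate domain, $\mathfrak{f}=\hat{\mathfrak{f}}(x_u,z)$, $g=g_{\hat{\mathfrak{f}},\mathcal{H},c}$ and $u=e^{\mathcal{F}}dx_u$, with $\mathcal{F}$ formed from $\hat{\mathfrak{f}}$ and $c$. (2) Consequently, for a given torsion function $\mathfrak{f}(x_u,z)$, such metrics are locally parametrized by one function $\mathcal{H}$ of two variables and one function $c$ of one variable: besides (1), for all smooth $\mathfrak{f},\mathcal{H}:\mathbb{R}^2\to\mathbb{R}$ and $c:\mathbb{R}\to\mathbb{R}$, the tuple $(\mathbb{R}^3,g_{\mathfrak{f},\mathcal{H},c},e^{\mathcal{F}}dx_u,\mathfrak{f})$,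 oriented by the volume form $e^{\mathcal{F}}dx_u\wedge dx_v\wedge dz$, is a skew-torsion Lorentzian three-manifold; and for fixed $\mathfrak{f}$, if $g_{\mathfrak{f},\mathcal{H},c}$ and $g_{\mathfrak{f},\mathcal{H}',c'}$ agree at a point with coordinates $(x_u,x_v,z)$, then $\mathcal{H}(x_u,z)=\mathcal{H}'(x_u,z)$ and $c(x_u)=c'(x_u)$. -/

import Mathlib

open Set Bundle
open scoped Manifold ContDiff

noncomputable section

namespace SkewTorsion

/-- The model space `ℝ³`; its coordinates `0, 1, 2` are written `x_u, x_v, z`. -/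
abbrev E3 : Type := EuclideanSpace ℝ (Fin 3)

section Fields

variable (M : Type*) [TopologicalSpace M] [ChartedSpace E3 M]

/-- Vector fields on a three-manifold (no regularity imposed). -/
abbrev VField : Type _ := ∀ x : M, TangentSpace (𝓡 3) x

/-- One-forms on a three-manifold (no regularity imposed). -/
abbrev OneForm : Type _ := ∀ x : M, TangentSpace (𝓡 3) x →L[ℝ] ℝ

/-- Fields of bilinear forms on the tangent spaces (no regularity imposed). -/
abbrev BilinField : Type _ :=
  ∀ x : M, TangentSpace (𝓡 3) x →L[ℝ] TangentSpace (𝓡 3) x →L[ℝ] ℝ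

/-- Fields of alternating three-forms (no regularity imposed). -/
abbrev ThreeForm : Type _ := ∀ x : M, (TangentSpace (𝓡 3) x) [⋀^Fin 3]→ₗ[ℝ] ℝ

end Fields

/-- The Minkowski matrix of signature `(2,1)`, that is `diag(-1, 1, 1)`. -/
def minkowski : Matrix (Fin 3) (Fin 3) ℝ := Matrix.diagonal ![-1, 1, 1]

/-- The basis `1, diag(1,-1), offdiag(1,1)` of the symmetric `2 × 2` matrices. With the quadratic
form `-det`, these matrices form a Minkowski space, in which this basis is orthonormal. -/
def symBasis : Fin 3 → Matrix (Fin 2) (Fin 2) ℝ :=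
  ![!![1, 0; 0, 1], !![1, 0; 0, -1], !![0, 1; 1, 0]]

/-- The double covering `Spin₀(2,1) = SL(2,ℝ) → SO₀(2,1)`: the matrix, in the basis `symBasis`, of
the map `S ↦ A S Aᵀ` on symmetric matrices, so that
`A * symBasis b * Aᵀ = ∑ a, spinCover A a b • symBasis a`. -/
def spinCover (A : Matrix.SpecialLinearGroup (Fin 2) ℝ) : Matrix (Fin 3) (Fin 3) ℝ :=
  Matrix.of fun a b =>
    (1 / 2 : ℝ) * Matrix.trace
      (symBasis a * (A : Matrix (Fin 2) (Fin 2) ℝ) * symBasis b *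
        (A : Matrix (Fin 2) (Fin 2) ℝ).transpose)

section Geometry

variable {M : Type*} [TopologicalSpace M] [ChartedSpace E3 M] [IsManifold (𝓡 3) ∞ M]

/-- `X` is smooth on the set `U`. -/
def SmoothVFieldOn (X : VField M) (U : Set M) : Prop :=
  ContMDiffOn (𝓡 3) ((𝓡 3).prod 𝓘(ℝ, E3)) ∞
    (fun x => (TotalSpace.mk' E3 x (X x) : TangentBundle (𝓡 3) M)) U

/-- `u` is a smooth one-form. -/
def SmoothOneForm (u : OneForm M) : Prop :=
  ContMDiff (𝓡 3) ((𝓡 3).prod 𝓘(ℝ, E3 →L[ℝ] ℝ)) ∞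
    (fun x => (TotalSpace.mk' (E3 →L[ℝ] ℝ) x (u x) :
      TotalSpace (E3 →L[ℝ] ℝ) (fun x : M => TangentSpace (𝓡 3) x →L[ℝ] ℝ)))

/-- `g` is a smooth Lorentzian metric, of signature `(2,1)` (mostly plus). -/
structure IsLorentzMetric (g : BilinField M) : Prop where
  symm : ∀ (x : M) (v w : TangentSpace (𝓡 3) x), g x v w = g x w v
  signature : ∀ x : M, ∃ e : Module.Basis (Fin 3) ℝ (TangentSpace (𝓡 3) x),
    ∀ a b, g x (e a) (e b) = minkowski a b
  smooth : ContMDiff (𝓡 3) ((𝓡 3).prod 𝓘(ℝ, E3 →L[ℝ] E3 →L[ℝ] ℝ)) ∞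
    (fun x => (TotalSpace.mk' (E3 →L[ℝ] E3 →L[ℝ] ℝ) x (g x) :
      TotalSpace (E3 →L[ℝ] E3 →L[ℝ] ℝ)
        (fun x : M => TangentSpace (𝓡 3) x →L[ℝ] TangentSpace (𝓡 3) x →L[ℝ] ℝ)))

/-- A `Spin₀(2,1)`-structure on the Lorentzian three-manifold `(M, g)`, oriented by the volume form
`ν`. It consists of smooth positively oriented orthonormal frames on open sets covering `M`
(indexed by the points of `M`), together with lifts of their transition functions to
`Spin₀(2,1) = SL(2,ℝ)` that satisfy the cocycle condition. In particular the transition functions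
take values in `SO₀(2,1)`, so that `ν` is the volume form of `g` and of an orientation of `M`, and
`(M, g)` is time-orientable. -/
structure SpinStructure (g : BilinField M) (ν : ThreeForm M) where
  /-- the open cover -/
  U : M → Set M
  isOpen_U : ∀ p, IsOpen (U p)
  mem_U : ∀ p, p ∈ U p
  /-- the local frames -/
  e : M → Fin 3 → VField M
  smooth_e : ∀ p a, SmoothVFieldOn (e p a) (U p)
  orthonormal : ∀ p, ∀ x ∈ U p, ∀ a b, g x (e p a x) (e p b x) = minkowski a b
  oriented : ∀ p, ∀ x ∈ U p, ν x (fun a => e p a x) = 1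
  /-- the lifted transition functions -/
  s : M → M → M → Matrix.SpecialLinearGroup (Fin 2) ℝ
  continuous_s : ∀ p q, ContinuousOn
    (fun x => (s p q x : Matrix (Fin 2) (Fin 2) ℝ)) (U p ∩ U q)
  transition : ∀ p q, ∀ x ∈ U p ∩ U q, ∀ b,
    e q b x = ∑ a, spinCover (s p q x) a b • e p a x
  cocycle : ∀ p q r, ∀ x ∈ U p ∩ U q ∩ U r, s p q x * s q r x = s p r x

/-- `(M, g)`, oriented by the volume form `ν`, is a strongly spin Lorentzian three-manifold. -/
structure IsStronglySpinLorentz (g : BilinField M) (ν : ThreeForm M) : Prop where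
  lorentz : IsLorentzMetric g
  spin : Nonempty (SpinStructure g ν)

open Classical in
/-- The metric dual `α^♯` of a covector: the vector with `g(α^♯, ·) = α`, which exists and is unique
as `g` is nondegenerate. -/
def sharp (g : BilinField M) (x : M) (α : TangentSpace (𝓡 3) x →L[ℝ] ℝ) :
    TangentSpace (𝓡 3) x :=
  if h : ∃ U : TangentSpace (𝓡 3) x, ∀ w, g x U w = α w then h.choose else 0

/-- `u` is isotropic: nowhere vanishing, and of vanishing norm, `g^*(u, u) = u(u^♯) = 0`. -/
def IsIsotropic (g : BilinField M) (u : OneForm M) : Prop :=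
  ∀ x : M, u x ≠ 0 ∧ u x (sharp g x (u x)) = 0

/-- The Hodge dual `*u = u ⌟ ν` of a one-form, which is the two-form `ν(u^♯, ·, ·)`. -/
def hodge (g : BilinField M) (ν : ThreeForm M) (u : OneForm M) (x : M)
    (v w : TangentSpace (𝓡 3) x) : ℝ :=
  ν x ![sharp g x (u x), v, w]

/-- `D` is the Levi-Civita connection of `g`: it is torsion-free, and
`v(g(Y, Z)) = g(D_v Y, Z) + g(Y, D_v Z)`. In Mathlib, `D Y x v` stands for `D_v Y`. -/
structure IsLeviCivita (g : BilinField M)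
    (D : CovariantDerivative (𝓡 3) E3 (TangentSpace (𝓡 3) : M → Type _)) : Prop where
  torsion_free : D.torsion = 0
  metric : ∀ (x : M) (Y Z : VField M),
    MDifferentiableAt (𝓡 3) ((𝓡 3).prod 𝓘(ℝ, E3))
      (fun y => (TotalSpace.mk' E3 y (Y y) : TangentBundle (𝓡 3) M)) x →
    MDifferentiableAt (𝓡 3) ((𝓡 3).prod 𝓘(ℝ, E3))
      (fun y => (TotalSpace.mk' E3 y (Z y) : TangentBundle (𝓡 3) M)) x →
    ∀ v : TangentSpace (𝓡 3) x,
      mvfderiv (𝓡 3) (fun y => g y (Y y) (Z y)) x v = g x (D Y x v) (Z x) + g x (Y x) (D Z x v)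

/-- The equation `∇^g u = f *u`, in which `(∇_v u)(Y) = v(u(Y)) - u(∇_v Y)`. -/
def SkewTorsionEquation (g : BilinField M) (ν : ThreeForm M) (u : OneForm M) (f : M → ℝ) : Prop :=
  ∃ D : CovariantDerivative (𝓡 3) E3 (TangentSpace (𝓡 3) : M → Type _), IsLeviCivita g D ∧
    ∀ (x : M) (Y : VField M),
      MDifferentiableAt (𝓡 3) ((𝓡 3).prod 𝓘(ℝ, E3))
        (fun y => (TotalSpace.mk' E3 y (Y y) : TangentBundle (𝓡 3) M)) x →
      ∀ v : TangentSpace (𝓡 3) x,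
        mvfderiv (𝓡 3) (fun y => u y (Y y)) x v - u x (D Y x v) = f x * hodge g ν u x v (Y x)

/-- `(M, g, u, f)`, oriented by the volume form `ν`, is a skew-torsion Lorentzian
three-manifold. -/
structure IsSkewTorsion (g : BilinField M) (ν : ThreeForm M) (u : OneForm M) (f : M → ℝ) :
    Prop where
  stronglySpin : IsStronglySpinLorentz g ν
  smooth_u : SmoothOneForm u
  isotropic : IsIsotropic g u
  smooth_f : ContMDiff (𝓡 3) 𝓘(ℝ, ℝ) ∞ f
  equation : SkewTorsionEquation g ν u f

end Geometry

section Model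

/-- The coordinate one-form `dx_i` on `ℝ³`. -/
def dCoord (i : Fin 3) : E3 →L[ℝ] ℝ := EuclideanSpace.proj i

/-- The exponent `2 ∫ f dz + c(x_u)`, with the primitive of `f` in `z` that vanishes at `z = 0`. -/
def exponent (f : ℝ × ℝ → ℝ) (c : ℝ → ℝ) (p : E3) : ℝ :=
  2 * (∫ s in (0 : ℝ)..(p 2), f (p 0, s)) + c (p 0)

/-- The bilinear form `H dx_u ⊗ dx_u + e^{2 ∫ f dz + c} dx_u ⊙ dx_v + dz ⊗ dz` at `p ∈ ℝ³`, with
`f` and `H` evaluated at `(x_u, z)` and `c` at `x_u`; here `α ⊙ β = α ⊗ β + β ⊗ α`. -/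
def modelMetricAt (f H : ℝ × ℝ → ℝ) (c : ℝ → ℝ) (p : E3) : E3 →L[ℝ] E3 →L[ℝ] ℝ :=
  H (p 0, p 2) • (dCoord 0).smulRight (dCoord 0)
    + Real.exp (exponent f c p) •
      ((dCoord 0).smulRight (dCoord 1) + (dCoord 1).smulRight (dCoord 0))
    + (dCoord 2).smulRight (dCoord 2)

/-- The metric `H dx_u ⊗ dx_u + e^{2 ∫ f dz + c} dx_u ⊙ dx_v + dz ⊗ dz` on the manifold `ℝ³`. -/
def modelMetric (f H : ℝ × ℝ → ℝ) (c : ℝ → ℝ) : BilinField E3 :=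
  fun p => modelMetricAt f H c p

/-- The covector `e^{2 ∫ f dz + c} dx_u` at `p ∈ ℝ³`. -/
def modelFormAt (f : ℝ × ℝ → ℝ) (c : ℝ → ℝ) (p : E3) : E3 →L[ℝ] ℝ :=
  Real.exp (exponent f c p) • dCoord 0

/-- The one-form `e^{2 ∫ f dz + c} dx_u` on the manifold `ℝ³`. -/
def modelForm (f : ℝ × ℝ → ℝ) (c : ℝ → ℝ) : OneForm E3 :=
  fun p => modelFormAt f c p

/-- The alternating form `e^{2 ∫ f dz + c} dx_u ∧ dx_v ∧ dz` at `p ∈ ℝ³`. -/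
def modelVolumeAt (f : ℝ × ℝ → ℝ) (c : ℝ → ℝ) (p : E3) : E3 [⋀^Fin 3]→ₗ[ℝ] ℝ :=
  Real.exp (exponent f c p) • (EuclideanSpace.basisFun (Fin 3) ℝ).toBasis.det

/-- The three-form `e^{2 ∫ f dz + c} dx_u ∧ dx_v ∧ dz` on the manifold `ℝ³`. -/
def modelVolume (f : ℝ × ℝ → ℝ) (c : ℝ → ℝ) : ThreeForm E3 :=
  fun p => modelVolumeAt f c p

end Model

end SkewTorsion

end

/-! Let `U` be the metric dual of `u`. The equation `∇u = f *u` says `g(∇_v U, Y) = f ν(U, v, Y)`.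
The right side is skew in `v` and `Y`, so `U` is a Killing field and `du = 2 f *u`. In a chart with
`U = ∂_{x_v}` (flow box theorem, `exists_isAdapted`), the metric components are therefore
independent of `x_v`, while isotropy gives `g_vv = 0`; `IsAdapted.structure_equations` records the
two consequences of the equation.

Two changes of coordinates that preserve `U = ∂_{x_v}` bring `g` to diagonal form. A unit vector
field orthogonal to `U` in the `(x_u, z)`-plane is straightened to `∂_z`
(`exists_orthogonal_adapted_chart`), and a shear `x_v ↦ x_v - k(x_u, z)` then kills `g_uz`
(`exists_diagonal_adapted_chart`). What remains is `H = g_uu` and `E = g_uv > 0`, with `u = E dx_u`.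
Now `du = 2 f *u` reads `∂_z E = 2 f E`: this forces `f` to be independent of `x_v`, and it
integrates to `E = e^{2 ∫ f dz + c(x_u)}` (`IsAdapted.exists_normal_form`).

Conversely, the model metric does not depend on `x_v`, so the Koszul formula gives `∇u = du / 2`,
and the same differential equation yields `∇u = f *u` (`isSkewTorsion_model`). The parameters are
recovered from the components `g_uu` and `g_uv`.

The straightenings need local flows that depend smoothly on the initial point. These come from the
inverse function theorem on a Banach space of continuous curves. Bump functions extend the local
coefficients to globally smooth ones. -/

namespace SkewTorsion

/-! ### Smoothness of composition operators on spaces of continuous maps. -/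

section Superposition

set_option synthInstance.maxHeartbeats 200000

open Filter Topology

variable {K : Type} [TopologicalSpace K] [CompactSpace K]
  {E F : Type} [NormedAddCommGroup E] [NormedSpace ℝ E] [NormedAddCommGroup F] [NormedSpace ℝ F]

/-- Pointwise application of a continuous family of linear maps, as a continuous bilinear map. -/
noncomputable def pointwiseApply (K E F : Type) [TopologicalSpace K] [CompactSpace K]
    [NormedAddCommGroup E] [NormedSpace ℝ E] [NormedAddCommGroup F] [NormedSpace ℝ F] :
    C(K, E →L[ℝ] F) →L[ℝ] C(K, E) →L[ℝ] C(K, F) :=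
  LinearMap.mkContinuous₂
    (LinearMap.mk₂ ℝ
      (fun (A : C(K, E →L[ℝ] F)) (γ : C(K, E)) =>
        (⟨fun t => A t (γ t), A.continuous.clm_apply γ.continuous⟩ : C(K, F)))
      (fun _ _ _ => by ext; simp) (fun _ _ _ => by ext; simp)
      (fun _ _ _ => by ext; simp) (fun _ _ _ => by ext; simp)) 1
    (fun (A : C(K, E →L[ℝ] F)) (γ : C(K, E)) => by
      rw [ContinuousMap.norm_le _ (by positivity)]
      intro t
      calc ‖A t (γ t)‖ ≤ ‖A t‖ * ‖γ t‖ := (A t).le_opNorm _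
        _ ≤ 1 * ‖A‖ * ‖γ‖ := by
            rw [one_mul]
            gcongr
            exacts [A.norm_coe_le_norm t, γ.norm_coe_le_norm t])

/-- Pointwise mean value inequality, with an error bound uniform over `K`. -/
theorem hasFDerivAt_superposition {X : E → F} (hX : ContDiff ℝ 1 X) (γ : C(K, E)) :
    HasFDerivAt (fun γ : C(K, E) => (⟨X, hX.continuous⟩ : C(E, F)).comp γ)
      (pointwiseApply K E F
        ((⟨fderiv ℝ X, hX.continuous_fderiv one_ne_zero⟩ : C(E, E →L[ℝ] F)).comp γ)) γ := by
  rw [hasFDerivAt_iff_isLittleO_nhds_zero, Asymptotics.isLittleO_iff]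
  intro ε hε
  set X' : C(E, E →L[ℝ] F) := ⟨fderiv ℝ X, hX.continuous_fderiv one_ne_zero⟩ with hX'
  -- Continuity of composition with `X'` in the sup norm replaces uniform continuity of `X'`: a
  -- point of the segment from `γ t` to `γ t + h t` is the value at `t` of a curve `γ + s • h`,
  -- which is close to `γ`.
  have hc : Tendsto (fun δ : C(K, E) => X'.comp δ) (𝓝 γ) (𝓝 (X'.comp γ)) :=
    (ContinuousMap.continuous_postcomp X').continuousAt
  obtain ⟨δ, hδ, hc⟩ :=
    (Metric.tendsto_nhds_nhds (α := C(K, E)) (β := C(K, E →L[ℝ] F))).1 hc ε hε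
  filter_upwards [Metric.ball_mem_nhds (0 : C(K, E)) hδ] with h hh
  rw [mem_ball_zero_iff] at hh
  rw [ContinuousMap.norm_le _ (by positivity)]
  intro t
  have key := (convex_segment (γ t) (γ t + h t)).norm_image_sub_le_of_norm_fderiv_le' (𝕜 := ℝ)
    (f := X) (C := ε) (φ := fderiv ℝ X (γ t))
    (fun x _ => (hX.differentiable one_ne_zero) x) ?_ (left_mem_segment ℝ _ _)
    (right_mem_segment ℝ _ _)
  · simp only [add_sub_cancel_left] at key
    refine key.trans ?_
    gcongr
    exact h.norm_coe_le_norm t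
  · intro x hx
    rw [segment_eq_image'] at hx
    obtain ⟨s, hs, rfl⟩ := hx
    have h1 : dist (γ + s • h) γ < δ := by
      rw [dist_eq_norm, add_sub_cancel_left, norm_smul, Real.norm_of_nonneg hs.1]
      exact lt_of_le_of_lt (mul_le_of_le_one_left (norm_nonneg _) hs.2) hh
    have h2 := (ContinuousMap.dist_apply_le_dist t).trans (hc h1).le
    rw [dist_eq_norm] at h2
    simpa [hX'] using h2

/-- The superposition operator `γ ↦ X ∘ γ` of a smooth map is smooth. -/
theorem contDiff_superposition {X : E → F} (hX : ContDiff ℝ ∞ X) :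
    ContDiff ℝ ∞ (fun γ : C(K, E) => (⟨X, hX.continuous⟩ : C(E, F)).comp γ) := by
  rw [contDiff_infty]
  intro n
  -- The derivative is a bounded linear image of the superposition operator of `fderiv ℝ X`, whose
  -- values lie in `E →L[ℝ] F`; hence `F` has to vary.
  induction n generalizing F with
  | zero => exact contDiff_zero.2 (ContinuousMap.continuous_postcomp _)
  | succ n ih =>
    have h1 : ContDiff ℝ 1 X := hX.of_le (by exact_mod_cast le_top)
    push_cast
    rw [contDiff_succ_iff_fderiv]
    refine ⟨fun γ => (hasFDerivAt_superposition h1 γ).differentiableAt, by simp, ?_⟩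
    rw [show fderiv ℝ (fun γ : C(K, E) => (⟨X, hX.continuous⟩ : C(E, F)).comp γ) = fun γ =>
        pointwiseApply K E F ((⟨fderiv ℝ X, h1.continuous_fderiv one_ne_zero⟩ :
          C(E, E →L[ℝ] F)).comp γ) from
      funext fun γ => (hasFDerivAt_superposition h1 γ).fderiv]
    exact (pointwiseApply K E F).contDiff.comp
      (ih (contDiff_infty_iff_fderiv.1 hX).2)

end Superposition

/-! ### Smooth local inverses and global extension of smooth germs. -/

section InverseFunction

open Filter Topology

/-- A map that is smooth near a point, with invertible derivative there, is a local homeomorphism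
with a smooth inverse. -/
theorem exists_smooth_localInverse {E F : Type*} [NormedAddCommGroup E] [NormedSpace ℝ E]
    [CompleteSpace E] [NormedAddCommGroup F] [NormedSpace ℝ F] {f : E → F} {a : E}
    {f' : E ≃L[ℝ] F} (hf : ∀ᶠ x in 𝓝 a, ContDiffAt ℝ ∞ f x) (hf' : HasFDerivAt f (f' : E →L[ℝ] F) a) :
    ∃ e : OpenPartialHomeomorph E F, a ∈ e.source ∧ (∀ x, e x = f x) ∧
      (∀ x ∈ e.source, ContDiffAt ℝ ∞ f x ∧ (fderiv ℝ f x).IsInvertible) ∧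
      ∀ y ∈ e.target, ContDiffAt ℝ ∞ e.symm y := by
  have ha := hf.self_of_nhds
  let e₀ := ha.toOpenPartialHomeomorph f hf' (by simp)
  have hcont : ContinuousAt (fderiv ℝ f) a :=
    (ha.fderiv_right (m := 0) (by simp)).continuousAt
  have hinv : ∀ᶠ x in 𝓝 a, (fderiv ℝ f x).IsInvertible := by
    refine hcont (ContinuousLinearEquiv.isOpen.mem_nhds ?_)
    exact ⟨f', hf'.fderiv.symm⟩
  obtain ⟨W, hW, hWo, haW⟩ := eventually_nhds_iff.1 (hf.and hinv)
  -- On `W` the map is smooth with invertible derivative at every point, not only at `a`; this makes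
  -- the inverse smooth on the whole target.
  refine ⟨e₀.restrOpen W hWo, ?_, fun _ => rfl, ?_, ?_⟩
  · exact ⟨ha.mem_toOpenPartialHomeomorph_source hf' (by simp), haW⟩
  · exact fun x hx => hW x hx.2
  · intro y hy
    have hx := hW _ ((e₀.restrOpen W hWo).map_target hy).2
    obtain ⟨g', hg'⟩ := hx.2
    refine (e₀.restrOpen W hWo).contDiffAt_symm (f₀' := g') hy ?_ hx.1
    rw [hg']
    exact (hx.1.differentiableAt (by simp)).hasFDerivAt

/-- A map that is smooth near a point agrees near this point with a globally smooth map. -/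
theorem exists_contDiff_eventuallyEq {E F : Type*} [NormedAddCommGroup E] [NormedSpace ℝ E]
    [FiniteDimensional ℝ E] [NormedAddCommGroup F] [NormedSpace ℝ F] {f : E → F} {a : E}
    (hf : ∀ᶠ x in 𝓝 a, ContDiffAt ℝ ∞ f x) :
    ∃ g : E → F, ContDiff ℝ ∞ g ∧ g =ᶠ[𝓝 a] f := by
  obtain ⟨r, hr, hW⟩ := Metric.eventually_nhds_iff_ball.1 hf
  let χ : ContDiffBump a := ⟨r / 3, r / 2, by positivity, by linarith⟩
  refine ⟨fun x => χ x • f x, ?_, ?_⟩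
  · rw [contDiff_iff_contDiffAt]
    intro x
    by_cases hx : x ∈ Metric.ball a r
    · exact χ.contDiffAt.smul (hW x hx)
    · have hx' : x ∉ tsupport χ := by
        rw [χ.tsupport_eq]
        intro h
        exact hx (Metric.closedBall_subset_ball (by change r / 2 < r; linarith) h)
      have h0 : (fun x => χ x • f x) =ᶠ[𝓝 x] fun _ => 0 := by
        filter_upwards [(isClosed_tsupport χ).isOpen_compl.mem_nhds hx'] with y hy
        rw [image_eq_zero_of_notMem_tsupport hy, zero_smul]
      exact contDiffAt_const.congr_of_eventuallyEq h0
  · filter_upwards [χ.eventuallyEq_one] with x hx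
    simp [hx]

end InverseFunction

/-! ### Smooth local flows of vector fields, and smooth parameter integrals. -/

section Flow

open Filter Topology unitInterval

variable {E : Type} [NormedAddCommGroup E] [NormedSpace ℝ E]

/-- The primitive vanishing at `0` of a continuous curve on the unit interval. -/
noncomputable def curvePrimitive (E : Type) [NormedAddCommGroup E] [NormedSpace ℝ E] :
    C(I, E) →L[ℝ] C(I, E) :=
  LinearMap.mkContinuous
    { toFun := fun γ => ⟨fun t => ∫ s in (0 : ℝ)..t, γ (projIcc 0 1 zero_le_one s),
        (intervalIntegral.continuous_primitive (fun _ _ =>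
          (γ.continuous.comp continuous_projIcc).intervalIntegrable _ _) 0).comp
          continuous_subtype_val⟩
      map_add' := fun γ γ' => by
        ext t
        simp only [ContinuousMap.add_apply, ContinuousMap.coe_mk]
        exact intervalIntegral.integral_add
          ((γ.continuous.comp continuous_projIcc).intervalIntegrable _ _)
          ((γ'.continuous.comp continuous_projIcc).intervalIntegrable _ _)
      map_smul' := fun c γ => by
        ext t
        simp } 1
    (fun γ => by
      rw [ContinuousMap.norm_le _ (by positivity)]
      intro t
      refine (intervalIntegral.norm_integral_le_of_norm_le_const (C := ‖γ‖)
        fun s _ => γ.norm_coe_le_norm _).trans ?_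
      rw [sub_zero, abs_of_nonneg t.2.1, one_mul]
      exact mul_le_of_le_one_right (norm_nonneg _) t.2.2)

theorem curvePrimitive_apply (γ : C(I, E)) (t : I) :
    curvePrimitive E γ t = ∫ s in (0 : ℝ)..t, γ (projIcc 0 1 zero_le_one s) := rfl

/-- The substitution `s ↦ z s` turns the integral into `z ∫₀¹ b(x, z s) ds`. The curve `s ↦ (x, z
s)` is linear in `(x, z)`, so this is a composite of a linear map, a superposition operator and a
linear functional, multiplied by `z`. -/
theorem contDiff_integral_param {b : ℝ × ℝ → ℝ} (hb : ContDiff ℝ ∞ b) :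
    ContDiff ℝ ∞ (fun p : ℝ × ℝ => ∫ s in (0 : ℝ)..p.2, b (p.1, s)) := by
  let c₁ : C(I, ℝ × ℝ) := ⟨fun _ => (1, 0), continuous_const⟩
  let c₂ : C(I, ℝ × ℝ) := ⟨fun s => (0, s), by fun_prop⟩
  have h1 : ContDiff ℝ ∞ (fun p : ℝ × ℝ => p.1 • c₁ + p.2 • c₂) := by fun_prop
  have h2 := (ContinuousMap.evalCLM ℝ (1 : I)).contDiff.comp
    ((curvePrimitive ℝ).contDiff.comp ((contDiff_superposition hb).comp h1))
  have h3 := (contDiff_snd (𝕜 := ℝ) (E := ℝ) (F := ℝ)).mul h2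
  refine Eq.mp (congrArg (ContDiff ℝ ∞) (funext fun p => ?_)) h3
  simp only [Function.comp_apply, ContinuousMap.evalCLM_apply, curvePrimitive_apply]
  have h4 := intervalIntegral.smul_integral_comp_mul_left (a := 0) (b := 1)
    (fun s => b (p.1, s)) p.2
  rw [mul_zero, mul_one, smul_eq_mul] at h4
  rw [← h4]
  congr 1
  refine intervalIntegral.integral_congr fun s hs => ?_
  rw [Icc.coe_one, uIcc_of_le zero_le_one] at hs
  simp [c₁, c₂, projIcc_of_mem zero_le_one hs]

variable [CompleteSpace E]

/-- The local flow of a smooth vector field exists and is smooth. -/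
theorem exists_smooth_flow_of_contDiff {X : E → E} (hX : ContDiff ℝ ∞ X) (x₀ : E) :
    ∃ Φ : ℝ × E → E, (∀ᶠ p in 𝓝 (0, x₀), ContDiffAt ℝ ∞ Φ p) ∧ (∀ᶠ x in 𝓝 x₀, Φ (0, x) = x) ∧
      ∀ᶠ p in 𝓝 ((0 : ℝ), x₀), HasDerivAt (fun t => Φ (t, p.2)) (X (Φ p)) p.1 := by
  let V : C(I, E) → C(I, E) := fun γ =>
    curvePrimitive E ((⟨X, hX.continuous⟩ : C(E, E)).comp γ)
  have hV : ContDiff ℝ ∞ V := (curvePrimitive E).contDiff.comp (contDiff_superposition hX)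
  have hV_apply : ∀ γ t, V γ t = ∫ s in (0 : ℝ)..t, X (γ (projIcc 0 1 zero_le_one s)) :=
    fun γ t => rfl
  let κ : E →L[ℝ] C(I, E) := ContinuousLinearMap.const ℝ I
  have hκ : ∀ x t, κ x t = x := fun x t => rfl
  -- With time rescaled to the unit interval, the integral curve from `x` over time `t` is the
  -- solution `γ` of `γ = x + t V(γ)`. Keeping `(t, x)` as the first component puts this equation in
  -- the range of the inverse function theorem.
  let Θ : (ℝ × E) × C(I, E) → (ℝ × E) × C(I, E) := fun q =>
    (q.1, q.2 - κ q.1.2 - q.1.1 • V q.2)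
  have hΘ : ContDiff ℝ ∞ Θ := by fun_prop
  let a : (ℝ × E) × C(I, E) := ((0, x₀), κ x₀)
  have hΘa : Θ a = ((0, x₀), 0) := by simp [Θ, a]
  let A : (ℝ × E) →L[ℝ] C(I, E) := -(κ ∘L ContinuousLinearMap.snd ℝ ℝ E) -
    (ContinuousLinearMap.fst ℝ ℝ E).smulRight (V (κ x₀))
  -- At `t = 0` the term `t V(γ)` contributes nothing to the derivative in `γ`, so the derivative of
  -- `Θ` is triangular with identities on the diagonal.
  have hΘ' : HasFDerivAt Θ (((ContinuousLinearEquiv.refl ℝ (ℝ × E)).skewProd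
      (ContinuousLinearEquiv.refl ℝ C(I, E)) A : _ ≃L[ℝ] _) :
      (ℝ × E) × C(I, E) →L[ℝ] (ℝ × E) × C(I, E)) a := by
    have h1 : HasFDerivAt (fun q : (ℝ × E) × C(I, E) => q.1.1 • V q.2) _ a :=
      (hasFDerivAt_fst.fst (𝕜 := ℝ)).fun_smul
        ((hV.differentiable (by simp) a.2).hasFDerivAt.comp a hasFDerivAt_snd)
    have h2 : HasFDerivAt (fun q : (ℝ × E) × C(I, E) => κ q.1.2) _ a :=
      κ.hasFDerivAt.comp a (hasFDerivAt_fst.snd (𝕜 := ℝ))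
    refine (hasFDerivAt_fst.prodMk ((hasFDerivAt_snd.sub h2).sub h1)).congr_fderiv ?_
    ext q <;> simp [a, A, sub_eq_add_neg, add_assoc]
  obtain ⟨e, hae, hee, -, hsymm⟩ := exists_smooth_localInverse
    (Eventually.of_forall fun q => hΘ.contDiffAt) hΘ'
  let ψ : ℝ × E → C(I, E) := fun p => (e.symm (p, 0)).2
  have hψ_unique : ∀ p γ, (p, γ) ∈ e.source → Θ (p, γ) = (p, 0) → ψ p = γ := by
    intro p γ hq hΘq
    rw [← hee] at hΘq
    simp only [ψ]
    rw [← hΘq, e.left_inv hq]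
  have hO : ∀ᶠ p in 𝓝 (0, x₀), ((p, 0) : (ℝ × E) × C(I, E)) ∈ e.target := by
    have hc : Continuous fun p : ℝ × E => ((p, 0) : (ℝ × E) × C(I, E)) := by fun_prop
    refine hc.continuousAt (e.open_target.mem_nhds ?_)
    rw [← hΘa, ← hee]
    exact e.map_source hae
  have hψ_smooth : ∀ᶠ p in 𝓝 (0, x₀), ContDiffAt ℝ ∞ ψ p := by
    filter_upwards [hO] with p hp
    exact contDiffAt_snd.comp p ((hsymm _ hp).comp p (contDiffAt_id.prodMk contDiffAt_const))
  have hψ_eq : ∀ p, ((p, 0) : (ℝ × E) × C(I, E)) ∈ e.target → ∀ t : I,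
      ψ p t = p.2 + p.1 • ∫ s in (0 : ℝ)..t, X (ψ p (projIcc 0 1 zero_le_one s)) := by
    intro p hp t
    have h1 := e.right_inv hp
    rw [hee] at h1
    have h2 : (e.symm (p, 0)).1 = p := congrArg Prod.fst h1
    have h3 := DFunLike.congr_fun (congrArg Prod.snd h1) t
    simp only [Θ, h2, ContinuousMap.sub_apply, ContinuousMap.smul_apply, hκ, hV_apply,
      ContinuousMap.zero_apply] at h3
    rw [sub_sub, sub_eq_zero] at h3
    exact h3
  have hψ₀ : ψ (0, x₀) = κ x₀ := hψ_unique _ _ hae hΘa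
  obtain ⟨r, hr, hball⟩ := Metric.isOpen_iff.1 e.open_source a hae
  have hnear : ∀ᶠ p in 𝓝 (0, x₀), dist (ψ p) (κ x₀) < r := by
    have := hψ_smooth.self_of_nhds.continuousAt
    rw [ContinuousAt, hψ₀] at this
    exact this (Metric.ball_mem_nhds _ hr)
  obtain ⟨δ, hδ, hgood⟩ := Metric.eventually_nhds_iff_ball.1
    ((hO.and hnear).and (Metric.ball_mem_nhds ((0 : ℝ), x₀) hr))
  have hscale : ∀ p ∈ Metric.ball ((0 : ℝ), x₀) δ, ∀ s ∈ Icc (0 : ℝ) 1,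
      (s * p.1, p.2) ∈ Metric.ball ((0 : ℝ), x₀) δ := by
    intro p hp s hs
    simp only [Metric.mem_ball, Prod.dist_eq, max_lt_iff, Real.dist_eq, sub_zero] at hp ⊢
    refine ⟨?_, hp.2⟩
    rw [abs_mul, abs_of_nonneg hs.1]
    exact lt_of_le_of_lt (mul_le_of_le_one_left (abs_nonneg _) hs.2) hp.1
  -- Running for time `s t` reaches the point of parameter `s` on the curve for time `t`: the
  -- reparametrized curve solves the equation for `(s t, x)`, and local injectivity of `Θ` gives
  -- uniqueness.
  have hrescale : ∀ p ∈ Metric.ball ((0 : ℝ), x₀) δ, ∀ s : I,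
      ψ (s * p.1, p.2) 1 = ψ p s := by
    intro p hp s
    let γ : C(I, E) := (ψ p).comp ⟨fun t => s * t, by fun_prop⟩
    have hγ : ∀ t, γ t = ψ p (s * t) := fun t => rfl
    have h1 : ψ (s * p.1, p.2) = γ := by
      refine hψ_unique _ _ (hball ?_) (Prod.ext rfl ?_)
      · rw [Metric.mem_ball, Prod.dist_eq, max_lt_iff]
        refine ⟨(hgood _ (hscale p hp s s.2)).2, ?_⟩
        refine lt_of_le_of_lt ?_ (hgood p hp).1.2
        rw [ContinuousMap.dist_le dist_nonneg]
        exact fun t => ContinuousMap.dist_apply_le_dist (f := ψ p) (g := κ x₀) (s * t)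
      · ext t
        simp only [Θ, ContinuousMap.sub_apply, ContinuousMap.smul_apply, hκ, hV_apply,
          ContinuousMap.zero_apply]
        rw [sub_sub, sub_eq_zero, hγ, hψ_eq p (hgood p hp).1.1 (s * t), mul_comm (s : ℝ) p.1,
          mul_smul]
        have h4 := intervalIntegral.smul_integral_comp_mul_left (a := 0) (b := t)
          (fun ρ => X (ψ p (projIcc 0 1 zero_le_one ρ))) s
        rw [mul_zero] at h4
        congr 2
        rw [Icc.coe_mul, ← h4]
        congr 1
        refine intervalIntegral.integral_congr fun ρ hρ => ?_
        rw [uIcc_of_le t.2.1] at hρ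
        have hρ1 : ρ ∈ Icc (0 : ℝ) 1 := ⟨hρ.1, hρ.2.trans t.2.2⟩
        have hρ2 : (s : ℝ) * ρ ∈ Icc (0 : ℝ) 1 :=
          ⟨mul_nonneg s.2.1 hρ1.1, mul_le_one₀ s.2.2 hρ1.1 hρ1.2⟩
        simp only [hγ, projIcc_of_mem zero_le_one hρ1, projIcc_of_mem zero_le_one hρ2]
        rfl
    rw [h1, hγ, mul_one]
  let Φ : ℝ × E → E := fun p => ψ p 1
  have hΦ_smooth : ∀ᶠ p in 𝓝 (0, x₀), ContDiffAt ℝ ∞ Φ p := by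
    filter_upwards [hψ_smooth] with p hp
    exact (ContinuousMap.evalCLM ℝ (1 : I)).contDiff.contDiffAt.comp p hp
  have hΦ_eq : ∀ p ∈ Metric.ball ((0 : ℝ), x₀) δ,
      Φ p = p.2 + ∫ s in (0 : ℝ)..p.1, X (Φ (s, p.2)) := by
    intro p hp
    simp only [Φ]
    rw [hψ_eq p (hgood p hp).1.1 1]
    have h4 := intervalIntegral.smul_integral_comp_mul_left (a := 0) (b := 1)
      (fun ρ => X (ψ (ρ, p.2) 1)) p.1
    rw [mul_zero, mul_one] at h4
    rw [← h4]
    congr 2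
    refine intervalIntegral.integral_congr fun ρ hρ => ?_
    rw [Icc.coe_one, uIcc_of_le zero_le_one] at hρ
    simp only [projIcc_of_mem zero_le_one hρ]
    rw [← hrescale p hp ⟨ρ, hρ⟩, mul_comm]
  refine ⟨Φ, hΦ_smooth, ?_, ?_⟩
  · have hc : Continuous fun x : E => ((0 : ℝ), x) := by fun_prop
    filter_upwards [hc.continuousAt (Metric.ball_mem_nhds ((0 : ℝ), x₀) hδ)] with x hx
    rw [hΦ_eq _ hx]
    simp
  · obtain ⟨δ', hδ', hsm⟩ := Metric.eventually_nhds_iff_ball.1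
      (hΦ_smooth.and (Metric.ball_mem_nhds ((0 : ℝ), x₀) hδ))
    filter_upwards [Metric.ball_mem_nhds ((0 : ℝ), x₀) hδ'] with p hp
    rw [Metric.mem_ball, Prod.dist_eq, max_lt_iff] at hp
    have hmem : ∀ t ∈ Metric.ball (0 : ℝ) δ', (t, p.2) ∈ Metric.ball ((0 : ℝ), x₀) δ' := by
      intro t ht
      rw [Metric.mem_ball, Prod.dist_eq, max_lt_iff]
      exact ⟨ht, hp.2⟩
    have hcont : ContinuousOn (fun t => X (Φ (t, p.2))) (Metric.ball (0 : ℝ) δ') := by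
      intro t ht
      refine (hX.continuous.continuousAt.comp (ContinuousAt.comp (f := fun t : ℝ => (t, p.2))
        (hsm _ (hmem t ht)).1.continuousAt (by fun_prop))).continuousWithinAt
    have hsub : uIcc 0 p.1 ⊆ Metric.ball (0 : ℝ) δ' :=
      (convex_ball (0 : ℝ) δ').ordConnected.uIcc_subset (Metric.mem_ball_self hδ') hp.1
    have hderiv := intervalIntegral.integral_hasDerivAt_right
      (hcont.mono hsub).intervalIntegrable
      (hcont.stronglyMeasurableAtFilter Metric.isOpen_ball p.1 hp.1)
      (hcont.continuousAt (Metric.isOpen_ball.mem_nhds hp.1))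
    refine (hderiv.const_add p.2).congr_of_eventuallyEq ?_
    filter_upwards [Metric.isOpen_ball.mem_nhds hp.1] with t ht
    exact hΦ_eq _ (hsm _ (hmem t ht)).2

/-- The local flow of a vector field that is smooth near a point. -/
theorem exists_smooth_flow [FiniteDimensional ℝ E] {X : E → E} {x₀ : E}
    (hX : ∀ᶠ x in 𝓝 x₀, ContDiffAt ℝ ∞ X x) :
    ∃ Φ : ℝ × E → E, (∀ᶠ p in 𝓝 (0, x₀), ContDiffAt ℝ ∞ Φ p) ∧ (∀ᶠ x in 𝓝 x₀, Φ (0, x) = x) ∧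
      ∀ᶠ p in 𝓝 ((0 : ℝ), x₀), HasDerivAt (fun t => Φ (t, p.2)) (X (Φ p)) p.1 := by
  obtain ⟨Y, hY, hYX⟩ := exists_contDiff_eventuallyEq hX
  obtain ⟨Φ, h1, h2, h3⟩ := exists_smooth_flow_of_contDiff hY x₀
  refine ⟨Φ, h1, h2, ?_⟩
  have hc := h1.self_of_nhds.continuousAt
  rw [ContinuousAt, h2.self_of_nhds] at hc
  filter_upwards [h3, hc.eventually hYX] with p hp hq
  rwa [hq] at hp

end Flow

/-! ### Coordinate vector fields and changes of charts. -/

section Charts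

open Filter Topology VectorField

variable {M : Type*} [TopologicalSpace M] [ChartedSpace E3 M]

/-- The vector field on the domain of a chart that has constant components `a` in the chart. -/
noncomputable def coordField (φ : OpenPartialHomeomorph M E3) (a : E3) : VField M :=
  mpullback (𝓡 3) (𝓡 3) φ (fun _ => a)

theorem coordField_apply (φ : OpenPartialHomeomorph M E3) (a : E3) (x : M) :
    coordField φ a x = (mfderiv (𝓡 3) (𝓡 3) φ x).inverse a := rfl

theorem coordField_add (φ : OpenPartialHomeomorph M E3) (a b : E3) (x : M) :
    coordField φ (a + b) x = coordField φ a x + coordField φ b x :=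
  map_add (mfderiv (𝓡 3) (𝓡 3) φ x).inverse a b

theorem coordField_smul (φ : OpenPartialHomeomorph M E3) (r : ℝ) (a : E3) (x : M) :
    coordField φ (r • a) x = r • coordField φ a x :=
  map_smul (mfderiv (𝓡 3) (𝓡 3) φ x).inverse r a

variable {φ : OpenPartialHomeomorph M E3} {x : M}

theorem mdifferentiable_of_mem_maximalAtlas
    (hφ : φ ∈ IsManifold.maximalAtlas (𝓡 3) ∞ M) : φ.MDifferentiable (𝓡 3) (𝓡 3) :=
  ⟨(contMDiffOn_of_mem_maximalAtlas hφ).mdifferentiableOn (by simp),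
    (contMDiffOn_symm_of_mem_maximalAtlas hφ).mdifferentiableOn (by simp)⟩

theorem isInvertible_mfderiv_of_mem_maximalAtlas
    (hφ : φ ∈ IsManifold.maximalAtlas (𝓡 3) ∞ M) (hx : x ∈ φ.source) :
    (mfderiv (𝓡 3) (𝓡 3) φ x).IsInvertible :=
  ⟨(mdifferentiable_of_mem_maximalAtlas hφ).mfderiv hx, rfl⟩

theorem mfderiv_coordField (hφ : φ ∈ IsManifold.maximalAtlas (𝓡 3) ∞ M) (hx : x ∈ φ.source)
    (a : E3) : mfderiv (𝓡 3) (𝓡 3) φ x (coordField φ a x) = a :=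
  (isInvertible_mfderiv_of_mem_maximalAtlas hφ hx).self_apply_inverse a

theorem coordField_mfderiv (hφ : φ ∈ IsManifold.maximalAtlas (𝓡 3) ∞ M) (hx : x ∈ φ.source)
    (v : TangentSpace (𝓡 3) x) : coordField φ (mfderiv (𝓡 3) (𝓡 3) φ x v) x = v :=
  (isInvertible_mfderiv_of_mem_maximalAtlas hφ hx).inverse_apply_self v

theorem contDiffAt_comp_symm (hφ : φ ∈ IsManifold.maximalAtlas (𝓡 3) ∞ M) {h : M → ℝ} {y : E3}
    (hy : y ∈ φ.target) (hh : ContMDiffAt (𝓡 3) 𝓘(ℝ, ℝ) ∞ h (φ.symm y)) :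
    ContDiffAt ℝ ∞ (fun z => h (φ.symm z)) y :=
  contMDiffAt_iff_contDiffAt.1
    (hh.comp y (contMDiffAt_symm_of_mem_maximalAtlas hφ hy))

theorem mvfderiv_coordField (hφ : φ ∈ IsManifold.maximalAtlas (𝓡 3) ∞ M) {h : M → ℝ} {y : E3}
    (hy : y ∈ φ.target) (hh : ContMDiffAt (𝓡 3) 𝓘(ℝ, ℝ) ∞ h (φ.symm y)) (a : E3) :
    mvfderiv (𝓡 3) h (φ.symm y) (coordField φ a (φ.symm y)) =
      fderiv ℝ (fun z => h (φ.symm z)) y a := by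
  have hx := φ.map_target hy
  have hd := (contDiffAt_comp_symm hφ hy hh).differentiableAt (by simp)
  have h1 : h =ᶠ[𝓝 (φ.symm y)] (fun z => h (φ.symm z)) ∘ φ := by
    filter_upwards [φ.open_source.mem_nhds hx] with z hz
    simp [φ.left_inv hz]
  have h2 : HasMFDerivAt (𝓡 3) 𝓘(ℝ, ℝ) h (φ.symm y)
      ((fderiv ℝ (fun z => h (φ.symm z)) y).comp (mfderiv (𝓡 3) (𝓡 3) φ (φ.symm y))) := by
    refine HasMFDerivAt.congr_of_eventuallyEq ?_ h1
    refine HasMFDerivAt.comp (I' := 𝓡 3) _ ?_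
      ((mdifferentiable_of_mem_maximalAtlas hφ).mdifferentiableAt hx).hasMFDerivAt
    rw [φ.right_inv hy]
    exact hd.hasFDerivAt.hasMFDerivAt
  change mfderiv (𝓡 3) 𝓘(ℝ, ℝ) h (φ.symm y) (coordField φ a (φ.symm y)) = _
  rw [h2.mfderiv]
  change fderiv ℝ (fun z => h (φ.symm z)) y
    (mfderiv (𝓡 3) (𝓡 3) φ (φ.symm y) (coordField φ a (φ.symm y))) = _
  rw [mfderiv_coordField hφ hx]

variable [IsManifold (𝓡 3) ∞ M]

theorem contMDiffAt_coordField (hφ : φ ∈ IsManifold.maximalAtlas (𝓡 3) ∞ M)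
    (hx : x ∈ φ.source) (a : E3) :
    ContMDiffAt (𝓡 3) ((𝓡 3).prod 𝓘(ℝ, E3)) ∞
      (fun y => (TotalSpace.mk' E3 y (coordField φ a y) : TangentBundle (𝓡 3) M)) x := by
  refine ContMDiffAt.mpullback_vectorField_preimage (n := ∞) ?_
    (contMDiffAt_of_mem_maximalAtlas hφ hx) (isInvertible_mfderiv_of_mem_maximalAtlas hφ hx)
    (by simp)
  exact contMDiffAt_vectorSpace_iff_contDiffAt.2 contDiffAt_const

/-- Pullback commutes with Lie brackets, and constant fields on `ℝ³` commute. -/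
theorem mlieBracket_coordField (hφ : φ ∈ IsManifold.maximalAtlas (𝓡 3) ∞ M)
    (hx : x ∈ φ.source) (a b : E3) :
    mlieBracket (𝓡 3) (coordField φ a) (coordField φ b) x = 0 := by
  have : IsManifold (𝓡 3) (minSmoothness ℝ 2) M := by
    rw [minSmoothness_of_isRCLikeNormedField]
    exact IsManifold.of_le (n := ∞) (by exact WithTop.coe_le_coe.2 le_top)
  have hc : ∀ c : E3, MDifferentiableAt (𝓡 3) ((𝓡 3).prod 𝓘(ℝ, E3))
      (fun y => (TotalSpace.mk' E3 y c : TangentBundle (𝓡 3) E3)) (φ x) := fun c =>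
    (contMDiffAt_vectorSpace_iff_contDiffAt (n := 1) (V := fun _ => c).2
      contDiffAt_const).mdifferentiableAt one_ne_zero
  have h := mpullback_mlieBracket (hc a) (hc b) (contMDiffAt_of_mem_maximalAtlas hφ hx)
    (by rw [minSmoothness_of_isRCLikeNormedField]; exact WithTop.coe_le_coe.2 le_top)
  unfold coordField
  have h0 : mlieBracket (𝓡 3) (fun _ => a : VField E3) (fun _ => b : VField E3) (φ x) = 0 :=
    (congrFun (mlieBracketWithin_univ (I := 𝓡 3) (V := fun _ => a) (W := fun _ => b))
      (φ x)).symm.trans ((congrFun (mlieBracketWithin_eq_lieBracketWithin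
        (V := fun _ => a) (W := fun _ => b) (s := univ)) (φ x)).trans
        (by simp [lieBracketWithin]; rfl))
  rw [← h, mpullback_apply]
  exact (congrArg _ h0).trans (map_zero _)

/-- A local diffeomorphism of `ℝ³` onto a neighbourhood of the image of `m` under a chart gives a
new chart around `m`. -/
theorem exists_chart_of_localDiffeo (hφ : φ ∈ IsManifold.maximalAtlas (𝓡 3) ∞ M) {m : M}
    (hm : m ∈ φ.source) {Ψ : E3 → E3} {L : E3 ≃L[ℝ] E3} (hΨ : ∀ᶠ y in 𝓝 0, ContDiffAt ℝ ∞ Ψ y)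
    (hΨ0 : Ψ 0 = φ m) (hL : HasFDerivAt Ψ (L : E3 →L[ℝ] E3) 0) {Q : E3 → Prop}
    (hQ : ∀ᶠ y in 𝓝 0, Q y) :
    ∃ φ' ∈ IsManifold.maximalAtlas (𝓡 3) ∞ M, m ∈ φ'.source ∧ φ' m = 0 ∧
      ∀ x ∈ φ'.source, x ∈ φ.source ∧ Q (φ' x) ∧ Ψ (φ' x) = φ x ∧
        ∀ a, coordField φ' a x = coordField φ (fderiv ℝ Ψ (φ' x) a) x := by
  obtain ⟨e₀, h0, he₀, hinv₀, hsymm₀⟩ := exists_smooth_localInverse hΨ hL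
  obtain ⟨W, hWQ, hWo, hW0⟩ := eventually_nhds_iff.1 hQ
  let e := e₀.restrOpen W hWo
  have hes : ∀ y ∈ e.source, y ∈ e₀.source ∧ y ∈ W := fun y hy => hy
  have he : ∀ y, e y = Ψ y := he₀
  have het : ∀ y ∈ e.target, y ∈ e₀.target := fun y hy => by
    have h1 := (e.map_target hy).1
    have h2 := e₀.map_source h1
    rwa [show e₀ (e.symm y) = y from e.right_inv hy] at h2
  have hesymm : ∀ y, e.symm y = e₀.symm y := fun y => rfl
  have he0 : (0 : E3) ∈ e.source := ⟨h0, hW0⟩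
  -- The new coordinates are `Ψ⁻¹ ∘ φ`, on a domain where `Q` holds; so `φ = Ψ ∘ φ'`, and the chain
  -- rule relates the coordinate fields.
  let φ' : OpenPartialHomeomorph M E3 := φ.trans e.symm
  have hφ's : ∀ x ∈ φ'.source, x ∈ φ.source ∧ φ x ∈ e.target := fun x hx => by
    simpa [φ'] using hx
  have hmax : φ' ∈ IsManifold.maximalAtlas (𝓡 3) ∞ M := by
    refine φ'.mem_maximalAtlas_of_contMDiffOn ?_ ?_
    · intro x hx
      have hx' := hφ's x hx
      refine ContMDiffAt.contMDiffWithinAt ?_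
      exact ContMDiffAt.comp (f := φ) (g := e₀.symm) (I' := 𝓡 3) x (hsymm₀ _ (het _ hx'.2)).contMDiffAt
        (contMDiffAt_of_mem_maximalAtlas hφ hx'.1)
    · intro y hy
      have hy' : y ∈ e.source ∧ Ψ y ∈ φ.target := by simpa [φ', he] using hy
      refine ContMDiffAt.contMDiffWithinAt ?_
      change ContMDiffAt (𝓡 3) (𝓡 3) ∞ (φ.symm ∘ e) y
      rw [show ⇑e = Ψ from funext he]
      exact ContMDiffAt.comp (f := Ψ) (g := φ.symm) (I' := 𝓡 3) y (contMDiffAt_symm_of_mem_maximalAtlas hφ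
        hy'.2)
        ((hinv₀ _ (hes _ hy'.1).1).1.contMDiffAt)
  have hval : ∀ x ∈ φ'.source, φ' x ∈ e.source ∧ Ψ (φ' x) = φ x := fun x hx => by
    have hx' := hφ's x hx
    refine ⟨e.map_target hx'.2, ?_⟩
    rw [← he]
    exact e.right_inv hx'.2
  refine ⟨φ', hmax, ?_, ?_, ?_⟩
  · have : φ m ∈ e.target := by rw [← hΨ0, ← he]; exact e.map_source he0
    simpa [φ'] using And.intro hm this
  · change e.symm (φ m) = 0
    rw [← hΨ0, ← he]
    exact e.left_inv he0
  · intro x hx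
    have hx' := hφ's x hx
    refine ⟨hx'.1, hWQ _ (hes _ (hval x hx).1).2, (hval x hx).2, fun a => ?_⟩
    have h1 : φ =ᶠ[𝓝 x] Ψ ∘ φ' := by
      filter_upwards [φ'.open_source.mem_nhds hx] with z hz
      exact (hval z hz).2.symm
    have h2 : HasMFDerivAt (𝓡 3) (𝓡 3) φ x
        ((fderiv ℝ Ψ (φ' x)).comp (mfderiv (𝓡 3) (𝓡 3) φ' x)) := by
      refine HasMFDerivAt.congr_of_eventuallyEq ?_ h1
      refine HasMFDerivAt.comp (I' := 𝓡 3) _ ?_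
        ((mdifferentiable_of_mem_maximalAtlas hmax).mdifferentiableAt hx).hasMFDerivAt
      exact ((hinv₀ _ (hes _ (hval x hx).1).1).1.differentiableAt
        (by simp)).hasFDerivAt.hasMFDerivAt
    rw [← coordField_mfderiv hφ hx'.1 (coordField φ' a x), h2.mfderiv]
    change coordField φ (fderiv ℝ Ψ (φ' x) (mfderiv (𝓡 3) (𝓡 3) φ' x (coordField φ' a x))) x = _
    rw [mfderiv_coordField hmax hx]

end Charts

/-! ### Orthonormal frames, metric duals and volume forms. -/

section LinearAlgebra

variable {M : Type*} [TopologicalSpace M] [ChartedSpace E3 M]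

theorem minkowski_apply (a b : Fin 3) :
    minkowski a b = if a = b then minkowski a a else 0 := by
  fin_cases a <;> fin_cases b <;> simp [minkowski]

theorem minkowski_mul_self (a : Fin 3) : minkowski a a * minkowski a a = 1 := by
  fin_cases a <;> simp [minkowski]

variable {g : BilinField M} {x : M} {e : Fin 3 → TangentSpace (𝓡 3) x}

/-- An orthonormal frame is a basis. -/
theorem exists_basis_of_orthonormal (he : ∀ a b, g x (e a) (e b) = minkowski a b) :
    ∃ b : Module.Basis (Fin 3) ℝ (TangentSpace (𝓡 3) x), ⇑b = e := by
  have hli : LinearIndependent ℝ e := by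
    rw [Fintype.linearIndependent_iff]
    intro c hc b
    have h1 : g x (∑ a, c a • e a) (e b) = 0 := by rw [hc, map_zero]; rfl
    have h2 : g x (∑ a, c a • e a) (e b) = c b * minkowski b b := by
      rw [map_sum, sum_apply, Finset.sum_eq_single b]
      · rw [map_smul, smul_apply, he, smul_eq_mul]
      · intro a _ hab
        rw [map_smul, smul_apply, he, minkowski_apply, if_neg hab, smul_zero]
      · simp
    have h3 := minkowski_mul_self b
    calc c b = (c b * minkowski b b) * minkowski b b := by rw [mul_assoc, h3, mul_one]
      _ = 0 := by rw [← h2, h1, zero_mul]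
  have hcard : Fintype.card (Fin 3) = Module.finrank ℝ (TangentSpace (𝓡 3) x) := by
    change _ = Module.finrank ℝ E3
    simp
  exact ⟨basisOfLinearIndependentOfCardEqFinrank hli hcard,
    coe_basisOfLinearIndependentOfCardEqFinrank hli hcard⟩

theorem repr_of_orthonormal {b : Module.Basis (Fin 3) ℝ (TangentSpace (𝓡 3) x)}
    (hb : ∀ i j, g x (b i) (b j) = minkowski i j) (v : TangentSpace (𝓡 3) x) (a : Fin 3) :
    b.repr v a = minkowski a a * g x (b a) v := by
  have h : g x (b a) v = minkowski a a * b.repr v a := by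
    conv_lhs => rw [← b.sum_repr v]
    rw [map_sum, Finset.sum_eq_single a]
    · rw [map_smul, hb, smul_eq_mul, mul_comm]
    · intro i _ hia
      rw [map_smul, hb, minkowski_apply, if_neg (Ne.symm hia), smul_zero]
    · simp
  rw [h, ← mul_assoc, minkowski_mul_self, one_mul]

theorem sum_of_orthonormal (he : ∀ a b, g x (e a) (e b) = minkowski a b)
    (v : TangentSpace (𝓡 3) x) : ∑ a, (minkowski a a * g x (e a) v) • e a = v := by
  obtain ⟨b, rfl⟩ := exists_basis_of_orthonormal he
  conv_rhs => rw [← b.sum_repr v]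
  simp_rw [repr_of_orthonormal he]

theorem sharp_spec (he : ∀ a b, g x (e a) (e b) = minkowski a b) (α : TangentSpace (𝓡 3) x →L[ℝ] ℝ)
    (w : TangentSpace (𝓡 3) x) : g x (sharp g x α) w = α w := by
  have hex : ∃ U : TangentSpace (𝓡 3) x, ∀ w, g x U w = α w := by
    refine ⟨∑ a, (minkowski a a * α (e a)) • e a, fun w => ?_⟩
    conv_rhs => rw [← sum_of_orthonormal he w]
    rw [map_sum, sum_apply, map_sum]
    refine Finset.sum_congr rfl fun a _ => ?_
    rw [map_smul, map_smul, smul_apply, smul_eq_mul, smul_eq_mul]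
    ring
  unfold sharp
  rw [dif_pos hex]
  exact hex.choose_spec w

theorem sharp_eq_sum (hs : ∀ v w, g x v w = g x w v)
    (he : ∀ a b, g x (e a) (e b) = minkowski a b) (α : TangentSpace (𝓡 3) x →L[ℝ] ℝ) :
    sharp g x α = ∑ a, (minkowski a a * α (e a)) • e a := by
  conv_lhs => rw [← sum_of_orthonormal he (sharp g x α)]
  refine Finset.sum_congr rfl fun a _ => ?_
  rw [hs, sharp_spec he]

theorem volume_eq_det {μ : (TangentSpace (𝓡 3) x) [⋀^Fin 3]→ₗ[ℝ] ℝ}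
    (he : ∀ a b, g x (e a) (e b) = minkowski a b) (hvol : μ (fun a => e a) = 1)
    (v : Fin 3 → TangentSpace (𝓡 3) x) :
    μ v = (Matrix.of fun a i => minkowski a a * g x (e a) (v i)).det := by
  obtain ⟨b, rfl⟩ := exists_basis_of_orthonormal he
  rw [μ.eq_smul_basis_det b, AlternatingMap.smul_apply, smul_eq_mul,
    show μ b = 1 from hvol, one_mul, Module.Basis.det_apply]
  congr 1
  ext a i
  rw [Module.Basis.toMatrix_apply, repr_of_orthonormal he, Matrix.of_apply]

/-- The Gram matrix is `Aᵀ η A` with `A` the matrix of components in the frame, `det A = μ v` and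
`det η = -1`. -/
theorem volume_sq {μ : (TangentSpace (𝓡 3) x) [⋀^Fin 3]→ₗ[ℝ] ℝ}
    (he : ∀ a b, g x (e a) (e b) = minkowski a b) (hvol : μ (fun a => e a) = 1)
    (v : Fin 3 → TangentSpace (𝓡 3) x) :
    μ v ^ 2 = -(Matrix.of fun i j => g x (v i) (v j)).det := by
  rw [volume_eq_det he hvol v]
  set A : Matrix (Fin 3) (Fin 3) ℝ := Matrix.of fun a i => minkowski a a * g x (e a) (v i)
  have hG : (Matrix.of fun i j => g x (v i) (v j)) = A.transpose * minkowski * A := by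
    ext i j
    rw [Matrix.of_apply, Matrix.mul_apply]
    conv_lhs => rw [← sum_of_orthonormal he (v i)]
    rw [map_sum, sum_apply]
    refine Finset.sum_congr rfl fun a _ => ?_
    have hm : (A.transpose * minkowski) i a = A a i * minkowski a a := by
      rw [minkowski, Matrix.mul_diagonal, Matrix.transpose_apply, Matrix.diagonal_apply_eq]
    rw [hm, map_smul, smul_apply, smul_eq_mul]
    simp only [A, Matrix.of_apply]
    linear_combination
      (-(minkowski a a * g x (e a) (v i) * g x (e a) (v j))) * minkowski_mul_self a
  rw [hG, Matrix.det_mul, Matrix.det_mul, Matrix.det_transpose]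
  simp [minkowski, Matrix.det_diagonal, Fin.prod_univ_three]
  ring

end LinearAlgebra

/-! ### Components of the metric, the volume form and the metric dual in a chart. -/

section CoordinateExpressions

open Filter Topology VectorField

variable {M : Type*} [TopologicalSpace M] [ChartedSpace E3 M]

/-- The coordinate vectors of `ℝ³`. -/
noncomputable def stdVec (i : Fin 3) : E3 := EuclideanSpace.single i 1

theorem sum_stdVec (a : E3) : a 0 • stdVec 0 + a 1 • stdVec 1 + a 2 • stdVec 2 = a := by
  ext i
  fin_cases i <;> simp [stdVec]

/-- The components of a metric in a chart, as functions on the target of the chart. -/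
noncomputable def coordMetric (g : BilinField M) (φ : OpenPartialHomeomorph M E3) (a b y : E3) : ℝ :=
  g (φ.symm y) (coordField φ a (φ.symm y)) (coordField φ b (φ.symm y))

/-- The components of a three-form in a chart, as functions on the target of the chart. -/
noncomputable def coordVolume (ν : ThreeForm M) (φ : OpenPartialHomeomorph M E3)
    (a b c y : E3) : ℝ :=
  ν (φ.symm y) ![coordField φ a (φ.symm y), coordField φ b (φ.symm y), coordField φ c (φ.symm y)]

section Algebra

variable (g : BilinField M) (ν : ThreeForm M) (φ : OpenPartialHomeomorph M E3) (a a' b c y : E3)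
  (r : ℝ)

theorem coordMetric_add_left :
    coordMetric g φ (a + a') b y = coordMetric g φ a b y + coordMetric g φ a' b y := by
  simp only [coordMetric, coordField_add, map_add, add_apply]

theorem coordMetric_add_right :
    coordMetric g φ a (b + c) y = coordMetric g φ a b y + coordMetric g φ a c y := by
  simp only [coordMetric, coordField_add, map_add]

theorem coordMetric_smul_left :
    coordMetric g φ (r • a) b y = r * coordMetric g φ a b y := by
  simp only [coordMetric, coordField_smul, map_smul, smul_apply, smul_eq_mul]

theorem coordMetric_smul_right :
    coordMetric g φ a (r • b) y = r * coordMetric g φ a b y := by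
  simp only [coordMetric, coordField_smul, map_smul, smul_eq_mul]

theorem coordVolume_swap_right : coordVolume ν φ a c b y = -coordVolume ν φ a b c y := by
  have h := (ν (φ.symm y)).map_swap (i := 1) (j := 2) ![coordField φ a (φ.symm y),
    coordField φ b (φ.symm y), coordField φ c (φ.symm y)] (by decide)
  rw [coordVolume, coordVolume, ← h]
  congr 1
  ext i
  fin_cases i <;> rfl

theorem coordVolume_swap_left : coordVolume ν φ b a c y = -coordVolume ν φ a b c y := by
  have h := (ν (φ.symm y)).map_swap (i := 0) (j := 1) ![coordField φ a (φ.symm y),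
    coordField φ b (φ.symm y), coordField φ c (φ.symm y)] (by decide)
  rw [coordVolume, coordVolume, ← h]
  congr 1
  ext i
  fin_cases i <;> rfl

theorem coordVolume_add_mid :
    coordVolume ν φ a (b + a') c y = coordVolume ν φ a b c y + coordVolume ν φ a a' c y := by
  have h := (ν (φ.symm y)).map_update_add ![coordField φ a (φ.symm y),
    coordField φ b (φ.symm y), coordField φ c (φ.symm y)] 1 (coordField φ b (φ.symm y))
    (coordField φ a' (φ.symm y))
  rw [coordVolume, coordField_add]
  convert h using 2
  · ext i
    fin_cases i <;> rfl
  · rw [coordVolume]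
    congr 1
    ext i
    fin_cases i <;> rfl
  · rw [coordVolume]
    congr 1
    ext i
    fin_cases i <;> rfl

theorem coordVolume_smul_mid :
    coordVolume ν φ a (r • b) c y = r * coordVolume ν φ a b c y := by
  have h := (ν (φ.symm y)).map_update_smul ![coordField φ a (φ.symm y),
    coordField φ b (φ.symm y), coordField φ c (φ.symm y)] 1 r (coordField φ b (φ.symm y))
  rw [coordVolume, coordField_smul, coordVolume]
  refine (congrArg _ ?_).trans (h.trans (congrArg (fun w => r * ν (φ.symm y) w) ?_))
  · ext i
    fin_cases i <;> rfl
  · ext i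
    fin_cases i <;> rfl

theorem coordVolume_self_right : coordVolume ν φ a b b y = 0 :=
  (ν (φ.symm y)).map_eq_zero_of_eq _ (i := 1) (j := 2) rfl (by decide)

theorem coordVolume_self_left : coordVolume ν φ a a b y = 0 :=
  (ν (φ.symm y)).map_eq_zero_of_eq _ (i := 0) (j := 1) rfl (by decide)

theorem coordVolume_self_outer : coordVolume ν φ a b a y = 0 :=
  (ν (φ.symm y)).map_eq_zero_of_eq _ (i := 0) (j := 2) rfl (by decide)

end Algebra

variable {φ : OpenPartialHomeomorph M E3} {y : E3}

theorem coordField_symm (hφ : φ ∈ IsManifold.maximalAtlas (𝓡 3) ∞ M) (hy : y ∈ φ.target)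
    (a : E3) : coordField φ a (φ.symm y) = mfderiv (𝓡 3) (𝓡 3) φ.symm y a := by
  rw [← coordField_mfderiv hφ (φ.map_target hy) (mfderiv (𝓡 3) (𝓡 3) φ.symm y a)]
  congr 1
  have h := (mdifferentiable_of_mem_maximalAtlas hφ).comp_symm_deriv hy
  exact (DFunLike.congr_fun h a).symm

variable [IsManifold (𝓡 3) ∞ M] {g : BilinField M} {ν : ThreeForm M} {u : OneForm M}

theorem contMDiffAt_metric_apply (hg : IsLorentzMetric g) {X Y : VField M} {x : M}
    (hX : ContMDiffAt (𝓡 3) ((𝓡 3).prod 𝓘(ℝ, E3)) ∞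
      (fun y => (TotalSpace.mk' E3 y (X y) : TangentBundle (𝓡 3) M)) x)
    (hY : ContMDiffAt (𝓡 3) ((𝓡 3).prod 𝓘(ℝ, E3)) ∞
      (fun y => (TotalSpace.mk' E3 y (Y y) : TangentBundle (𝓡 3) M)) x) :
    ContMDiffAt (𝓡 3) 𝓘(ℝ, ℝ) ∞ (fun y => g y (X y) (Y y)) x := by
  have h := ContMDiffAt.clm_bundle_apply₂ (F₁ := E3) (F₂ := E3) (F₃ := ℝ)
    (E₃ := Bundle.Trivial M ℝ) (hg.smooth x) hX hY
  exact ((contMDiffAt_section _).1 h)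

theorem contMDiffAt_form_apply (hu : SmoothOneForm u) {X : VField M} {x : M}
    (hX : ContMDiffAt (𝓡 3) ((𝓡 3).prod 𝓘(ℝ, E3)) ∞
      (fun y => (TotalSpace.mk' E3 y (X y) : TangentBundle (𝓡 3) M)) x) :
    ContMDiffAt (𝓡 3) 𝓘(ℝ, ℝ) ∞ (fun y => u y (X y)) x := by
  have h := ContMDiffAt.clm_bundle_apply (F₁ := E3) (F₂ := ℝ)
    (E₂ := Bundle.Trivial M ℝ) (hu x) hX
  exact ((contMDiffAt_section _).1 h)

theorem contDiffAt_coordMetric (hg : IsLorentzMetric g)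
    (hφ : φ ∈ IsManifold.maximalAtlas (𝓡 3) ∞ M) (a b : E3) (hy : y ∈ φ.target) :
    ContDiffAt ℝ ∞ (coordMetric g φ a b) y :=
  contDiffAt_comp_symm hφ hy (contMDiffAt_metric_apply hg
    (contMDiffAt_coordField hφ (φ.map_target hy) a) (contMDiffAt_coordField hφ (φ.map_target hy) b))

theorem coordMetric_symm (hg : IsLorentzMetric g) (a b y : E3) :
    coordMetric g φ a b y = coordMetric g φ b a y :=
  hg.symm _ _ _

theorem SpinStructure.contMDiffAt_frame (S : SpinStructure g ν) (x : M) (a : Fin 3) :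
    ContMDiffAt (𝓡 3) ((𝓡 3).prod 𝓘(ℝ, E3)) ∞
      (fun y => (TotalSpace.mk' E3 y (S.e x a y) : TangentBundle (𝓡 3) M)) x :=
  (S.smooth_e x a).contMDiffAt ((S.isOpen_U x).mem_nhds (S.mem_U x))

/-- `sharp` is defined by choice; its smoothness comes from expanding it in a smooth orthonormal
frame of the spin structure. -/
theorem contMDiffAt_sharp (hg : IsLorentzMetric g) (S : SpinStructure g ν)
    (hu : SmoothOneForm u) (x : M) :
    ContMDiffAt (𝓡 3) ((𝓡 3).prod 𝓘(ℝ, E3)) ∞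
      (fun y => (TotalSpace.mk' E3 y (sharp g y (u y)) : TangentBundle (𝓡 3) M)) x := by
  have h : ContMDiffAt (𝓡 3) ((𝓡 3).prod 𝓘(ℝ, E3)) ∞
      (fun y => (TotalSpace.mk' E3 y (∑ a, (minkowski a a * u y (S.e x a y)) • S.e x a y) :
        TangentBundle (𝓡 3) M)) x := by
    refine ContMDiffAt.sum_section fun a _ => ContMDiffAt.smul_section ?_ (S.contMDiffAt_frame x a)
    exact contMDiffAt_const.mul (contMDiffAt_form_apply hu (S.contMDiffAt_frame x a))
  refine h.congr_of_eventuallyEq ?_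
  filter_upwards [(S.isOpen_U x).mem_nhds (S.mem_U x)] with y hy
  rw [sharp_eq_sum (hg.symm y) (S.orthonormal x y hy)]

theorem metric_sharp (S : SpinStructure g ν) (x : M) (w : TangentSpace (𝓡 3) x) :
    g x (sharp g x (u x)) w = u x w :=
  sharp_spec (S.orthonormal x x (S.mem_U x)) _ w

/-- A `ThreeForm` carries no regularity of its own. Smoothness of `ν` follows from its value `1` on
smooth orthonormal frames, which makes it a determinant of smooth functions. -/
theorem contDiffAt_coordVolume (hg : IsLorentzMetric g) (S : SpinStructure g ν)
    (hφ : φ ∈ IsManifold.maximalAtlas (𝓡 3) ∞ M) (a b c : E3) (hy : y ∈ φ.target) :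
    ContDiffAt ℝ ∞ (coordVolume ν φ a b c) y := by
  have hx := φ.map_target hy
  refine contDiffAt_comp_symm hφ hy (h := fun x =>
    ν x ![coordField φ a x, coordField φ b x, coordField φ c x]) ?_
  set x := φ.symm y
  have hc : ∀ i d, ContMDiffAt (𝓡 3) 𝓘(ℝ, ℝ) ∞
      (fun z => minkowski i i * g z (S.e x i z) (coordField φ d z)) x := fun i d =>
    contMDiffAt_const.mul (contMDiffAt_metric_apply hg (S.contMDiffAt_frame x i)
      (contMDiffAt_coordField hφ hx d))
  have h : ∀ z ∈ S.U x, ν z ![coordField φ a z, coordField φ b z, coordField φ c z] =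
      (Matrix.of fun i j => minkowski i i *
        g z (S.e x i z) (coordField φ (![a, b, c] j) z)).det := by
    intro z hz
    rw [volume_eq_det (S.orthonormal x z hz) (S.oriented x z hz)]
    congr 2
    ext i j
    fin_cases j <;> rfl
  refine ContMDiffAt.congr_of_eventuallyEq ?_
    (eventually_of_mem ((S.isOpen_U x).mem_nhds (S.mem_U x)) h)
  simp only [Matrix.det_fin_three, Matrix.of_apply]
  exact ((((((hc 0 _).mul (hc 1 _)).mul (hc 2 _)).sub (((hc 0 _).mul (hc 1 _)).mul (hc 2 _))).sub
    (((hc 0 _).mul (hc 1 _)).mul (hc 2 _))).add (((hc 0 _).mul (hc 1 _)).mul (hc 2 _))).add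
    (((hc 0 _).mul (hc 1 _)).mul (hc 2 _)) |>.sub (((hc 0 _).mul (hc 1 _)).mul (hc 2 _))

theorem coordVolume_sq (S : SpinStructure g ν) (a b c y : E3) :
    coordVolume ν φ a b c y ^ 2 =
      -(Matrix.of fun i j => coordMetric g φ (![a, b, c] i) (![a, b, c] j) y).det := by
  rw [coordVolume, volume_sq (S.orthonormal _ _ (S.mem_U _)) (S.oriented _ _ (S.mem_U _))]
  congr 3
  ext i j
  fin_cases i <;> fin_cases j <;> rfl

/-- In a chart, the metric dual of a smooth one-form is a smooth vector field. -/
theorem exists_smooth_sharp (hg : IsLorentzMetric g) (S : SpinStructure g ν)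
    (hu : SmoothOneForm u) (hφ : φ ∈ IsManifold.maximalAtlas (𝓡 3) ∞ M) :
    ∃ X : E3 → E3, ∀ y ∈ φ.target, ContDiffAt ℝ ∞ X y ∧
      coordField φ (X y) (φ.symm y) = sharp g (φ.symm y) (u (φ.symm y)) := by
  have hinv : ∀ y ∈ φ.target, (mfderiv (𝓡 3) (𝓡 3) φ.symm y).IsInvertible := fun y hy =>
    ⟨(mdifferentiable_of_mem_maximalAtlas hφ).symm.mfderiv hy, rfl⟩
  refine ⟨mpullback (𝓡 3) (𝓡 3) φ.symm (fun x => sharp g x (u x)), fun y hy => ⟨?_, ?_⟩⟩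
  · exact contMDiffAt_vectorSpace_iff_contDiffAt.1
      (ContMDiffAt.mpullback_vectorField_preimage (n := ∞) (contMDiffAt_sharp hg S hu _)
        (contMDiffAt_symm_of_mem_maximalAtlas hφ hy) (hinv y hy) (by simp))
  · exact (coordField_symm hφ hy _).trans ((hinv y hy).self_apply_inverse _)

end CoordinateExpressions

/-! ### The Killing property and the equation `du = 2 f *u` in adapted charts. -/

section AdaptedCharts

open Filter Topology VectorField

variable {M : Type*} [TopologicalSpace M] [ChartedSpace E3 M] [IsManifold (𝓡 3) ∞ M]
  {g : BilinField M} {ν : ThreeForm M} {u : OneForm M} {f : M → ℝ}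
  {φ : OpenPartialHomeomorph M E3} {y : E3}

/-- A chart is adapted to `u` if the metric dual of `u` is the second coordinate vector field. -/
def IsAdapted (g : BilinField M) (u : OneForm M) (φ : OpenPartialHomeomorph M E3) : Prop :=
  ∀ x ∈ φ.source, sharp g x (u x) = coordField φ (stdVec 1) x

theorem IsAdapted.form_apply (h : IsAdapted g u φ) (S : SpinStructure g ν) (hy : y ∈ φ.target)
    (a : E3) : u (φ.symm y) (coordField φ a (φ.symm y)) = coordMetric g φ (stdVec 1) a y := by
  rw [coordMetric, ← h _ (φ.map_target hy), metric_sharp S]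

theorem IsAdapted.coordMetric_one_one (h : IsAdapted g u φ) (S : SpinStructure g ν)
    (hu : IsIsotropic g u) (hy : y ∈ φ.target) :
    coordMetric g φ (stdVec 1) (stdVec 1) y = 0 := by
  rw [← h.form_apply S hy, ← h _ (φ.map_target hy)]
  exact (hu _).2

/-- The structure equations of a skew-torsion three-manifold in an adapted chart: the components
of the metric are invariant under translations of the second coordinate, and the exterior
derivative of `u` is `2 f *u`. -/
theorem IsAdapted.structure_equations (h : IsAdapted g u φ) (hst : IsSkewTorsion g ν u f)
    (hφ : φ ∈ IsManifold.maximalAtlas (𝓡 3) ∞ M) (hy : y ∈ φ.target) (a b : E3) :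
    fderiv ℝ (coordMetric g φ a b) y (stdVec 1) = 0 ∧
    fderiv ℝ (coordMetric g φ (stdVec 1) b) y a - fderiv ℝ (coordMetric g φ (stdVec 1) a) y b =
      2 * f (φ.symm y) * coordVolume ν φ (stdVec 1) a b y := by
  obtain ⟨S⟩ := hst.stronglySpin.spin
  have hg := hst.stronglySpin.lorentz
  obtain ⟨D, hD, heq⟩ := hst.equation
  have hx := φ.map_target hy
  set x := φ.symm y with hxy
  let Y : E3 → VField M := coordField φ
  have hY : ∀ a, MDifferentiableAt (𝓡 3) ((𝓡 3).prod 𝓘(ℝ, E3))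
      (fun y => (TotalSpace.mk' E3 y (Y a y) : TangentBundle (𝓡 3) M)) x := fun a =>
    (contMDiffAt_coordField hφ hx a).mdifferentiableAt (by simp)
  -- Coordinate fields commute, so vanishing torsion is symmetry of `∇_{Y a} (Y b)`.
  have htor : ∀ a b, D (Y b) x (Y a x) = D (Y a) x (Y b x) := by
    intro a b
    have h1 := D.torsion_eq_zero_iff.1 hD.torsion_free (hY a) (hY b)
    rw [mlieBracket_coordField hφ hx] at h1
    exact sub_eq_zero.1 h1
  have hmet : ∀ a b c, fderiv ℝ (coordMetric g φ b c) y a =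
      g x (D (Y b) x (Y a x)) (Y c x) + g x (Y b x) (D (Y c) x (Y a x)) := by
    intro a b c
    rw [← hD.metric x (Y b) (Y c) (hY b) (hY c) (Y a x)]
    exact (mvfderiv_coordField hφ hy (contMDiffAt_metric_apply hg
      (contMDiffAt_coordField hφ hx b) (contMDiffAt_coordField hφ hx c)) a).symm
  have hsharp : sharp g x (u x) = Y (stdVec 1) x := h x hx
  have hform : ∀ a b, fderiv ℝ (coordMetric g φ (stdVec 1) b) y a -
      g x (Y (stdVec 1) x) (D (Y b) x (Y a x)) =
        f x * coordVolume ν φ (stdVec 1) a b y := by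
    intro a b
    have h1 := heq x (Y b) (hY b) (Y a x)
    have h2 := mvfderiv_coordField hφ hy (contMDiffAt_form_apply hst.smooth_u
      (contMDiffAt_coordField hφ hx b)) a
    have h3 : (fun z => u (φ.symm z) (coordField φ b (φ.symm z))) =ᶠ[𝓝 y]
        coordMetric g φ (stdVec 1) b := by
      filter_upwards [φ.open_target.mem_nhds hy] with z hz
      exact h.form_apply S hz b
    rw [h3.fderiv_eq] at h2
    rw [← h2, ← hsharp, metric_sharp S]
    refine h1.trans ?_
    rw [hodge, hsharp]
    rfl
  -- Metric compatibility moves the derivative from `u` to `U`: `g(∇_a U, Y_b) = f ν(U, Y_a, Y_b)`.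
  -- Skewness in `a, b` is the Killing equation.
  have hkey : ∀ a b, g x (D (Y (stdVec 1)) x (Y a x)) (Y b x) =
      f x * coordVolume ν φ (stdVec 1) a b y := by
    intro a b
    linarith [hform a b, hmet a (stdVec 1) b]
  constructor
  · rw [hmet, htor, hkey, hg.symm, htor, hkey, coordVolume_swap_right]
    ring
  · have h1 := hform a b
    have h2 := hform b a
    rw [htor a b] at h1
    rw [coordVolume_swap_right] at h2
    linarith

theorem hasDerivAt_det_zero {h : Fin 3 → Fin 3 → ℝ → ℝ} {t : ℝ}
    (hh : ∀ i j, HasDerivAt (h i j) 0 t) :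
    HasDerivAt (fun s => (Matrix.of fun i j => h i j s).det) 0 t := by
  simp only [Matrix.det_fin_three, Matrix.of_apply]
  have hp : ∀ i j k l m n, HasDerivAt (fun s => h i j s * h k l s * h m n s) 0 t := by
    intro i j k l m n
    simpa using ((hh i j).fun_mul (hh k l)).fun_mul (hh m n)
  simpa using (((((hp 0 0 1 1 2 2).fun_sub (hp 0 0 1 2 2 1)).fun_sub
    (hp 0 1 1 0 2 2)).fun_add (hp 0 1 1 2 2 0)).fun_add (hp 0 2 1 0 2 1)).fun_sub
    (hp 0 2 1 1 2 0)

/-- The square of the component is minus a Gram determinant, whose entries have zero derivative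
along `U`. Where the component is nonzero, its own derivative then vanishes too. -/
theorem IsAdapted.fderiv_coordVolume (h : IsAdapted g u φ) (hst : IsSkewTorsion g ν u f)
    (hφ : φ ∈ IsManifold.maximalAtlas (𝓡 3) ∞ M) (hy : y ∈ φ.target) (a b c : E3)
    (hne : coordVolume ν φ a b c y ≠ 0) :
    fderiv ℝ (coordVolume ν φ a b c) y (stdVec 1) = 0 := by
  obtain ⟨S⟩ := hst.stronglySpin.spin
  have hg := hst.stronglySpin.lorentz
  have hline : HasDerivAt (fun t : ℝ => y + t • stdVec 1) (stdVec 1) 0 := by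
    simpa using ((hasDerivAt_id (0 : ℝ)).smul_const (stdVec 1)).const_add y
  have hcomp : ∀ F : E3 → ℝ, ContDiffAt ℝ ∞ F y →
      HasDerivAt (fun t : ℝ => F (y + t • stdVec 1)) (fderiv ℝ F y (stdVec 1)) 0 := by
    intro F hF
    have h0 : y + (0 : ℝ) • stdVec 1 = y := by simp
    exact HasFDerivAt.comp_hasDerivAt (f := fun t : ℝ => y + t • stdVec 1) 0
      (by rw [h0]; exact (hF.differentiableAt (by simp)).hasFDerivAt) hline
  have h1 := (hcomp _ (contDiffAt_coordVolume hg S hφ a b c hy)).fun_pow 2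
  have h2 : HasDerivAt (fun t : ℝ => coordVolume ν φ a b c (y + t • stdVec 1) ^ 2) (-0) 0 := by
    simp only [coordVolume_sq S]
    refine (hasDerivAt_det_zero fun i j => ?_).fun_neg
    have h3 := hcomp _ (contDiffAt_coordMetric hg hφ (![a, b, c] i) (![a, b, c] j) hy)
    rwa [(h.structure_equations hst hφ hy _ _).1] at h3
  have h4 := h1.unique h2
  simpa [hne] using h4

end AdaptedCharts

/-! ### Straightening the metric dual of `u`. -/

section AdaptedChartExists

open Filter Topology VectorField

theorem fderiv_flow_zero {E : Type*} [NormedAddCommGroup E] [NormedSpace ℝ E] {X : E → E}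
    {Φ : ℝ × E → E} {x₀ : E} (hΦ : ContDiffAt ℝ ∞ Φ (0, x₀)) (h0 : ∀ᶠ x in 𝓝 x₀, Φ (0, x) = x)
    (hflow : HasDerivAt (fun t => Φ (t, x₀)) (X (Φ (0, x₀))) 0) (t : ℝ) (v : E) :
    fderiv ℝ Φ (0, x₀) (t, v) = t • X x₀ + v := by
  have hd := (hΦ.differentiableAt (by simp)).hasFDerivAt
  have h1 : fderiv ℝ Φ (0, x₀) (1, 0) = X x₀ := by
    have h2 := hd.comp_hasDerivAt (f := fun t : ℝ => (t, x₀)) (0 : ℝ)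
      ((hasDerivAt_id 0).prodMk (hasDerivAt_const 0 x₀))
    rw [h2.unique hflow, h0.self_of_nhds]
  have h2 : fderiv ℝ Φ (0, x₀) (0, v) = v := by
    have h3 := hd.comp (f := fun x : E => ((0 : ℝ), x)) x₀
      ((hasFDerivAt_const (0 : ℝ) x₀).prodMk (hasFDerivAt_id x₀))
    have h4 := h3.unique ((hasFDerivAt_id x₀).congr_of_eventuallyEq h0)
    simpa using DFunLike.congr_fun h4 v
  have h3 : ((t, v) : ℝ × E) = t • (1, 0) + (0, v) := by simp
  rw [h3, map_add, map_smul, h1, h2]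

variable {M : Type*} [TopologicalSpace M] [ChartedSpace E3 M]

theorem coordField_zero (φ : OpenPartialHomeomorph M E3) (x : M) : coordField φ 0 x = 0 :=
  map_zero (mfderiv (𝓡 3) (𝓡 3) φ x).inverse

variable [IsManifold (𝓡 3) ∞ M]
  {g : BilinField M} {ν : ThreeForm M} {u : OneForm M} {f : M → ℝ}

/-- Flow box theorem for the dual field `X`, which vanishes nowhere because `u` does not. -/
theorem exists_isAdapted (hst : IsSkewTorsion g ν u f) (m : M) :
    ∃ φ ∈ IsManifold.maximalAtlas (𝓡 3) ∞ M, m ∈ φ.source ∧ φ m = 0 ∧ IsAdapted g u φ := by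
  obtain ⟨S⟩ := hst.stronglySpin.spin
  have hg := hst.stronglySpin.lorentz
  let φ : OpenPartialHomeomorph M E3 := chartAt E3 m
  have hφ : φ ∈ IsManifold.maximalAtlas (𝓡 3) ∞ M := IsManifold.chart_mem_maximalAtlas m
  have hm : m ∈ φ.source := mem_chart_source E3 m
  obtain ⟨X, hX⟩ := exists_smooth_sharp hg S hst.smooth_u hφ
  set p := φ m
  have hp : p ∈ φ.target := φ.map_source hm
  have hXp : X p ≠ 0 := by
    intro h0
    have h1 := (hX p hp).2
    rw [h0, coordField_zero] at h1
    refine (hst.isotropic (φ.symm p)).1 ?_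
    ext w
    rw [← metric_sharp (g := g) S, ← h1, map_zero]
  obtain ⟨L, hL⟩ := SeparatingDual.exists_continuousLinearEquiv_apply_eq (R := ℝ)
    (x := stdVec 1) (y := X p) (by simp [stdVec]) hXp
  obtain ⟨Φ, hΦ, hΦ0, hΦX⟩ := exists_smooth_flow
    (eventually_of_mem (φ.open_target.mem_nhds hp) fun y hy => (hX y hy).1)
  -- The straightening map is `y ↦ Φ(y₁, p + L(y - y₁ e₁))`: flow for time `y₁` from a point of a
  -- hyperplane transverse to `X p`. Since `L e₁ = X p`, its derivative at `0` is exactly `L`.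
  let A : E3 →L[ℝ] ℝ × E3 := (dCoord 1).prod
    ((L : E3 →L[ℝ] E3) ∘L (ContinuousLinearMap.id ℝ E3 - (dCoord 1).smulRight (stdVec 1)))
  have hA : ∀ a, A a = (a 1, L (a - a 1 • stdVec 1)) := fun a => rfl
  have hstd : (stdVec 1) 1 = 1 := by simp [stdVec]
  have hA1 : A (stdVec 1) = (1, 0) := by rw [hA, hstd]; simp
  let B : E3 → ℝ × E3 := fun y => (0, p) + A y
  have hB : ContDiff ℝ ∞ B := by fun_prop
  have hB0 : B 0 = (0, p) := by simp [B]
  have hBd : ∀ y, HasFDerivAt B A y := fun y => A.hasFDerivAt.const_add _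
  have hBc : Tendsto B (𝓝 0) (𝓝 (0, p)) := by
    rw [← hB0]
    exact hB.continuous.continuousAt
  have hΨ : ∀ᶠ y in 𝓝 0, ContDiffAt ℝ ∞ (Φ ∘ B) y := by
    filter_upwards [hBc.eventually hΦ] with y hy
    exact hy.comp y hB.contDiffAt
  have hder : ∀ a, fderiv ℝ Φ (0, p) (A a) = L a := by
    intro a
    rw [hA, fderiv_flow_zero hΦ.self_of_nhds hΦ0 hΦX.self_of_nhds, ← hL, ← map_smul, ← map_add]
    simp
  obtain ⟨φ', hφ', hm', hm0, h⟩ := exists_chart_of_localDiffeo hφ hm (Ψ := Φ ∘ B) (L := L) hΨ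
    (by rw [Function.comp_apply, hB0, hΦ0.self_of_nhds]) (by
      have hd : HasFDerivAt Φ (fderiv ℝ Φ (0, p)) (B 0) := by
        rw [hB0]
        exact (hΦ.self_of_nhds.differentiableAt (by simp)).hasFDerivAt
      refine (hd.comp 0 (hBd 0)).congr_fderiv ?_
      ext1 a
      exact hder a)
    -- This is the flow equation: moving along `e₁` changes only the time, so the image of `e₁` is
    -- `X`.
    (Q := fun y => fderiv ℝ (Φ ∘ B) y (stdVec 1) = X ((Φ ∘ B) y)) (by
      filter_upwards [hBc.eventually hΦ, hBc.eventually hΦX] with y hy hy'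
      have hd := (hy.differentiableAt (by simp)).hasFDerivAt
      rw [(hd.comp y (hBd y)).fderiv, ContinuousLinearMap.comp_apply, hA1]
      have h2 := hd.comp_hasDerivAt (f := fun t : ℝ => (t, (B y).2)) (B y).1
        ((hasDerivAt_id _).prodMk (hasDerivAt_const _ _))
      exact h2.unique hy')
  refine ⟨φ', hφ', hm', hm0, fun x hx => ?_⟩
  obtain ⟨hxs, hQ, hΨx, hcoord⟩ := h x hx
  rw [hcoord, hQ, hΨx]
  have h3 := (hX _ (φ.map_source hxs)).2
  rw [φ.left_inv hxs] at h3
  exact h3.symm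

end AdaptedChartExists

/-! ### Functions on a cube that do not depend on `x_v`. -/

section Cubes

open Filter Topology

theorem exists_cube_subset {s : Set E3} (hs : s ∈ 𝓝 0) :
    ∃ r > 0, ∀ y : E3, (∀ i, |y i| < r) → y ∈ s := by
  obtain ⟨ε, hε, h⟩ := Metric.mem_nhds_iff.1 hs
  refine ⟨ε / 3, by positivity, fun y hy => h ?_⟩
  rw [mem_ball_zero_iff, ← sum_stdVec y]
  have hn : ∀ i : Fin 3, ‖y i • stdVec i‖ = |y i| := fun i => by
    simp [norm_smul, stdVec]
  calc ‖y 0 • stdVec 0 + y 1 • stdVec 1 + y 2 • stdVec 2‖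
      ≤ ‖y 0 • stdVec 0‖ + ‖y 1 • stdVec 1‖ + ‖y 2 • stdVec 2‖ := norm_add₃_le
    _ < ε := by rw [hn, hn, hn]; linarith [hy 0, hy 1, hy 2]

/-- The inclusion of the plane with coordinates `x_u, z`. -/
noncomputable def planeIncl : ℝ × ℝ →L[ℝ] E3 :=
  (ContinuousLinearMap.fst ℝ ℝ ℝ).smulRight (stdVec 0) +
    (ContinuousLinearMap.snd ℝ ℝ ℝ).smulRight (stdVec 2)

theorem planeIncl_apply (q : ℝ × ℝ) : planeIncl q = q.1 • stdVec 0 + q.2 • stdVec 2 := rfl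

@[simp] theorem planeIncl_zero_coord (q : ℝ × ℝ) : planeIncl q 0 = q.1 := by
  simp [planeIncl_apply, stdVec]

@[simp] theorem planeIncl_one_coord (q : ℝ × ℝ) : planeIncl q 1 = 0 := by
  simp [planeIncl_apply, stdVec]

@[simp] theorem planeIncl_two_coord (q : ℝ × ℝ) : planeIncl q 2 = q.2 := by
  simp [planeIncl_apply, stdVec]

theorem planeIncl_add_smul (y : E3) : planeIncl (y 0, y 2) + y 1 • stdVec 1 = y := by
  conv_rhs => rw [← sum_stdVec y]
  rw [planeIncl_apply]
  abel

/-- The segment parallel to the `x_v`-axis from `y` to the plane stays in the cube, and the mean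
value inequality with constant `0` applies along it. -/
theorem eq_planeIncl_of_fderiv_eq_zero {F : E3 → ℝ} {r : ℝ}
    (hF : ∀ y : E3, (∀ i, |y i| < r) → DifferentiableAt ℝ F y)
    (hF' : ∀ y : E3, (∀ i, |y i| < r) → fderiv ℝ F y (stdVec 1) = 0) {y : E3}
    (hy : ∀ i, |y i| < r) : F y = F (planeIncl (y 0, y 2)) := by
  have hr : 0 < r := (abs_nonneg _).trans_lt (hy 0)
  have hmem : ∀ t ∈ Ioo (-r) r, ∀ i, |(planeIncl (y 0, y 2) + t • stdVec 1) i| < r := by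
    intro t ht i
    fin_cases i
    · simpa [stdVec] using hy 0
    · simpa [stdVec] using abs_lt.2 ht
    · simpa [stdVec] using hy 2
  have hd : ∀ t ∈ Ioo (-r) r, HasDerivWithinAt
      (fun t : ℝ => F (planeIncl (y 0, y 2) + t • stdVec 1)) 0 (Ioo (-r) r) t := by
    intro t ht
    have hline : HasDerivAt (fun t : ℝ => planeIncl (y 0, y 2) + t • stdVec 1) (stdVec 1) t := by
      simpa using ((hasDerivAt_id t).smul_const (stdVec 1)).const_add (planeIncl (y 0, y 2))
    have h1 := (hF _ (hmem t ht)).hasFDerivAt.comp_hasDerivAt t hline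
    rw [hF' _ (hmem t ht)] at h1
    exact h1.hasDerivWithinAt
  have h := (convex_Ioo (-r) r).norm_image_sub_le_of_norm_hasDerivWithin_le (C := 0)
    hd (fun _ _ => by simp) (x := 0) (y := y 1) ⟨by linarith, hr⟩ (abs_lt.1 (hy 1))
  rw [planeIncl_add_smul, zero_smul, add_zero, zero_mul] at h
  exact sub_eq_zero.1 (norm_le_zero_iff.1 h)

end Cubes

/-! ### A unit coordinate field orthogonal to the metric dual of `u`. -/

section NormalForm

open Filter Topology VectorField

variable {M : Type*} [TopologicalSpace M] [ChartedSpace E3 M] [IsManifold (𝓡 3) ∞ M]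
  {g : BilinField M} {ν : ThreeForm M} {u : OneForm M} {f : M → ℝ}
  {φ : OpenPartialHomeomorph M E3}

theorem exists_equiv_of_injective {T : E3 →L[ℝ] E3} (hT : ∀ a, T a = 0 → a = 0) :
    ∃ L : E3 ≃L[ℝ] E3, (L : E3 →L[ℝ] E3) = T := by
  have hinj : Function.Injective (T : E3 →ₗ[ℝ] E3) :=
    (injective_iff_map_eq_zero _).2 hT
  refine ⟨(LinearEquiv.ofInjectiveEndo _ hinj).toContinuousLinearEquiv, ?_⟩
  ext1 a
  rfl

/-- Coordinate fields form a basis; a three-form vanishing on a basis is zero, whereas `ν` equals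
`1` on an orthonormal frame. -/
theorem coordVolume_ne_zero (S : SpinStructure g ν)
    (hφ : φ ∈ IsManifold.maximalAtlas (𝓡 3) ∞ M) {y : E3} (hy : y ∈ φ.target) :
    coordVolume ν φ (stdVec 0) (stdVec 1) (stdVec 2) y ≠ 0 := by
  intro h0
  have hx := φ.map_target hy
  set x := φ.symm y
  obtain ⟨L, hL⟩ := isInvertible_mfderiv_of_mem_maximalAtlas hφ hx
  let b : Module.Basis (Fin 3) ℝ (TangentSpace (𝓡 3) x) :=
    (EuclideanSpace.basisFun (Fin 3) ℝ).toBasis.map L.symm.toLinearEquiv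
  have hb : ∀ i, b i = coordField φ (stdVec i) x := by
    intro i
    have h1 : (mfderiv (𝓡 3) (𝓡 3) φ x).inverse = L.symm := by
      rw [← hL, ContinuousLinearMap.inverse_equiv]
    have h2 : (EuclideanSpace.basisFun (Fin 3) ℝ).toBasis i = stdVec i := by simp [stdVec]
    exact (congrArg L.symm h2).trans
      ((DFunLike.congr_fun h1 (stdVec i)).symm.trans (coordField_apply φ (stdVec i) x).symm)
  have h1 : ν x b = 0 := by
    rw [← h0, coordVolume]
    congr 1
    ext1 i
    rw [hb]
    fin_cases i <;> rfl
  have h2 := S.oriented x x (S.mem_U x)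
  rw [(ν x).eq_smul_basis_det b, h1] at h2
  simp at h2

/-- Changes of coordinates whose derivative fixes `e₁` preserve adaptedness. Both later changes of
coordinates are of this kind, and the components transform by the derivative of `Ψ`. -/
theorem exists_adapted_chart_of_localDiffeo (hφ : φ ∈ IsManifold.maximalAtlas (𝓡 3) ∞ M)
    (had : IsAdapted g u φ) {m : M} (hm : m ∈ φ.source) (hm0 : φ m = 0) {Ψ : E3 → E3}
    {T : E3 →L[ℝ] E3} (hΨ : ∀ᶠ y in 𝓝 0, ContDiffAt ℝ ∞ Ψ y) (hΨ0 : Ψ 0 = 0)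
    (hT : HasFDerivAt Ψ T 0) (hTinj : ∀ a, T a = 0 → a = 0)
    (hΨ1 : ∀ᶠ y in 𝓝 0, fderiv ℝ Ψ y (stdVec 1) = stdVec 1) {Q : E3 → Prop}
    (hQ : ∀ᶠ y in 𝓝 0, Q y) :
    ∃ φ' ∈ IsManifold.maximalAtlas (𝓡 3) ∞ M, m ∈ φ'.source ∧ φ' m = 0 ∧ IsAdapted g u φ' ∧
      ∀ y ∈ φ'.target, Ψ y ∈ φ.target ∧ Q y ∧
        (∀ a b, coordMetric g φ' a b y =
          coordMetric g φ (fderiv ℝ Ψ y a) (fderiv ℝ Ψ y b) (Ψ y)) ∧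
        ∀ a b c, coordVolume ν φ' a b c y =
          coordVolume ν φ (fderiv ℝ Ψ y a) (fderiv ℝ Ψ y b) (fderiv ℝ Ψ y c) (Ψ y) := by
  obtain ⟨L, rfl⟩ := exists_equiv_of_injective hTinj
  obtain ⟨φ', hφ', hm', hm0', h⟩ := exists_chart_of_localDiffeo hφ hm hΨ (hΨ0.trans hm0.symm) hT
    (hQ.and hΨ1)
  refine ⟨φ', hφ', hm', hm0', ?_, ?_⟩
  · intro x hx
    obtain ⟨hxs, hQx, -, hc⟩ := h x hx
    rw [hc, hQx.2]
    exact had x hxs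
  · intro y hy
    obtain ⟨hxs, hQx, hΨx, hc⟩ := h _ (φ'.map_target hy)
    rw [φ'.right_inv hy] at hQx hΨx hc
    have hsymm : φ.symm (Ψ y) = φ'.symm y := by rw [hΨx, φ.left_inv hxs]
    refine ⟨by rw [hΨx]; exact φ.map_source hxs, hQx.1, fun a b => ?_, fun a b c => ?_⟩
    · simp only [coordMetric, hc]
      rw [hsymm]
    · simp only [coordVolume, hc]
      rw [hsymm]

/-- Around every point there is an adapted chart in which the third coordinate vector field is
orthogonal to the second one, of norm one, and positively oriented. -/
theorem exists_orthogonal_adapted_chart (hst : IsSkewTorsion g ν u f) (m : M) :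
    ∃ φ ∈ IsManifold.maximalAtlas (𝓡 3) ∞ M, m ∈ φ.source ∧ φ m = 0 ∧ IsAdapted g u φ ∧
      (∀ y ∈ φ.target, coordMetric g φ (stdVec 1) (stdVec 2) y = 0 ∧
        coordMetric g φ (stdVec 2) (stdVec 2) y = 1 ∧
        coordVolume ν φ (stdVec 1) (stdVec 2) (stdVec 0) y =
          coordMetric g φ (stdVec 1) (stdVec 0) y) ∧
      0 < coordMetric g φ (stdVec 1) (stdVec 0) 0 := by
  obtain ⟨S⟩ := hst.stronglySpin.spin
  have hg := hst.stronglySpin.lorentz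
  obtain ⟨φ, hφ, hm, hm0, had⟩ := exists_isAdapted hst m
  have h0t : (0 : E3) ∈ φ.target := by rw [← hm0]; exact φ.map_source hm
  let G : Fin 3 → Fin 3 → E3 → ℝ := fun i j => coordMetric g φ (stdVec i) (stdVec j)
  let N : E3 → ℝ := coordVolume ν φ (stdVec 0) (stdVec 1) (stdVec 2)
  have hGs : ∀ i j, ∀ y ∈ φ.target, ContDiffAt ℝ ∞ (G i j) y := fun i j y hy =>
    contDiffAt_coordMetric hg hφ _ _ hy
  have hNs : ∀ y ∈ φ.target, ContDiffAt ℝ ∞ N y := fun y hy =>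
    contDiffAt_coordVolume hg S hφ _ _ _ hy
  have hN : ∀ y ∈ φ.target, N y ≠ 0 := fun y hy => coordVolume_ne_zero S hφ hy
  have hGsymm : ∀ i j y, G i j y = G j i y := fun i j y => coordMetric_symm hg _ _ _
  have hG11 : ∀ y ∈ φ.target, G 1 1 y = 0 := fun y hy =>
    had.coordMetric_one_one S hst.isotropic hy
  -- Minus the Gram determinant with `G 1 1 = 0`; this is the squared norm of `-G₁₂ ∂₀ + G₁₀ ∂₂`.
  have hNsq : ∀ y ∈ φ.target, N y ^ 2 =
      G 0 0 y * G 1 2 y ^ 2 + G 1 0 y ^ 2 * G 2 2 y - 2 * G 1 0 y * G 1 2 y * G 0 2 y := by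
    intro y hy
    have h1 := coordVolume_sq (φ := φ) S (stdVec 0) (stdVec 1) (stdVec 2) y
    simp only [Matrix.det_fin_three, Matrix.of_apply, Matrix.cons_val_zero, Matrix.cons_val_one,
      Matrix.cons_val_two, Matrix.head_cons, Matrix.tail_cons] at h1
    have e1 := hG11 y hy
    have e2 := hGsymm 0 1 y
    have e3 := hGsymm 2 0 y
    have e4 := hGsymm 2 1 y
    simp only [G, N] at e1 e2 e3 e4 ⊢
    rw [h1, e1, e2, e3, e4]
    ring
  obtain ⟨r, hr, hcube⟩ := exists_cube_subset (φ.open_target.mem_nhds h0t)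
  have hGinv : ∀ i j (y : E3), (∀ k, |y k| < r) → G i j y = G i j (planeIncl (y 0, y 2)) :=
    fun i j y hy => eq_planeIncl_of_fderiv_eq_zero
      (fun z hz => (hGs i j z (hcube z hz)).differentiableAt (by simp))
      (fun z hz => (had.structure_equations hst hφ (hcube z hz) _ _).1) hy
  have hNinv : ∀ y : E3, (∀ k, |y k| < r) → N y = N (planeIncl (y 0, y 2)) :=
    fun y hy => eq_planeIncl_of_fderiv_eq_zero
      (fun z hz => (hNs z (hcube z hz)).differentiableAt (by simp))
      (fun z hz => had.fderiv_coordVolume hst hφ (hcube z hz) _ _ _ (hN z (hcube z hz))) hy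
  -- The components of `u` are `G₁₀, G₁₁ = 0, G₁₂`, and `u` does not vanish.
  have hU0 : 0 < G 1 0 0 ^ 2 + G 1 2 0 ^ 2 := by
    by_contra hneg
    have h10 : G 1 0 0 = 0 := by nlinarith [sq_nonneg (G 1 0 0), sq_nonneg (G 1 2 0)]
    have h12 : G 1 2 0 = 0 := by nlinarith [sq_nonneg (G 1 0 0), sq_nonneg (G 1 2 0)]
    refine (hst.isotropic (φ.symm 0)).1 ?_
    ext v
    rw [← coordField_mfderiv hφ (φ.map_target h0t) v]
    refine (had.form_apply S h0t _).trans ?_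
    rw [← sum_stdVec (mfderiv (𝓡 3) (𝓡 3) φ (φ.symm 0) v)]
    simp only [coordMetric_add_right, coordMetric_smul_right]
    simp only [G] at h10 h12
    rw [h10, h12, show coordMetric g φ (stdVec 1) (stdVec 1) 0 = 0 from hG11 0 h0t]
    simp
  -- Up to scale, the only direction in the `(x_u, z)`-plane orthogonal to `U`. Dividing by `N`
  -- gives norm one by `hNsq`, and the sign of `N` makes `ν(U, w, ·) = u`. Invariance along `x_v`
  -- allows `w` to be treated as a field on the plane.
  let w : ℝ × ℝ → ℝ × ℝ := fun q =>
    (-G 1 2 (planeIncl q) / N (planeIncl q), G 1 0 (planeIncl q) / N (planeIncl q))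
  have hpl : Tendsto planeIncl (𝓝 0) (𝓝 0) := by
    have := planeIncl.continuous.continuousAt (x := 0)
    rwa [ContinuousAt, map_zero] at this
  have hw : ∀ᶠ q in 𝓝 0, ContDiffAt ℝ ∞ w q := by
    filter_upwards [hpl.eventually (φ.open_target.mem_nhds h0t)] with q hq
    have hp := planeIncl.contDiff.contDiffAt (n := ∞) (x := q)
    exact (((hGs 1 2 _ hq).comp q hp).neg.div ((hNs _ hq).comp q hp) (hN _ hq)).prodMk
      (((hGs 1 0 _ hq).comp q hp).div ((hNs _ hq).comp q hp) (hN _ hq))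
  obtain ⟨Φ, hΦ, hΦ0, hΦw⟩ := exists_smooth_flow hw
  -- The Euclidean normal to `w 0`: transverse to the flow, and `u` takes the positive value `G₁₀² +
  -- G₁₂²` on it, which fixes the sign of the new `g_uv`.
  let τ : ℝ × ℝ := (G 1 0 0, G 1 2 0)
  let B : E3 →L[ℝ] ℝ × (ℝ × ℝ) := (dCoord 2).prod ((dCoord 0).smulRight τ)
  have hB : ∀ a, B a = (a 2, a 0 • τ) := fun a => rfl
  have hBc : Tendsto B (𝓝 0) (𝓝 ((0 : ℝ), (0 : ℝ × ℝ))) := by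
    have := B.continuous.continuousAt (x := 0)
    rwa [ContinuousAt, map_zero] at this
  -- Flow along `w` for time `z` from the point `x_u τ` of a transversal, leaving `x_v` untouched.
  let Ψ : E3 → E3 := fun y => planeIncl (Φ (B y)) + y 1 • stdVec 1
  let T : E3 → E3 →L[ℝ] E3 := fun y =>
    planeIncl ∘L (fderiv ℝ Φ (B y) ∘L B) + (dCoord 1).smulRight (stdVec 1)
  have hT : ∀ y a, T y a = planeIncl (fderiv ℝ Φ (B y) (B a)) + a 1 • stdVec 1 :=
    fun y a => rfl
  have hΨd : ∀ y, ContDiffAt ℝ ∞ Φ (B y) → HasFDerivAt Ψ (T y) y := by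
    intro y hy
    exact ((planeIncl.hasFDerivAt.comp y ((hy.differentiableAt (by simp)).hasFDerivAt.comp y
      B.hasFDerivAt))).add ((dCoord 1).smulRight (stdVec 1)).hasFDerivAt
  have hB0 : B 0 = 0 := map_zero B
  have hΨs : ∀ᶠ y in 𝓝 0, ContDiffAt ℝ ∞ Ψ y := by
    filter_upwards [hBc.eventually hΦ] with y hy
    have h1 : ContDiffAt ℝ ∞ (fun y : E3 => y 1 • stdVec 1) y :=
      ((dCoord 1).smulRight (stdVec 1)).contDiff.contDiffAt
    exact (planeIncl.contDiff.contDiffAt.comp y (hy.comp y B.contDiff.contDiffAt)).add h1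
  have hΨ0 : Ψ 0 = 0 := by
    simp only [Ψ, hB0]
    rw [show (0 : ℝ × ℝ × ℝ) = (0, 0) from rfl, hΦ0.self_of_nhds]
    simp
  have hB1 : B (stdVec 1) = 0 := by rw [hB]; simp [stdVec]
  have hB2 : B (stdVec 2) = (1, 0) := by rw [hB]; simp [stdVec]
  have hT1 : ∀ y, T y (stdVec 1) = stdVec 1 := by
    intro y
    rw [hT, hB1, map_zero, map_zero, zero_add]
    simp [stdVec]
  have hT2 : ∀ᶠ y in 𝓝 0, T y (stdVec 2) = planeIncl (w (Φ (B y))) := by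
    filter_upwards [hBc.eventually hΦ, hBc.eventually hΦw] with y hy hy'
    have h2 := (hy.differentiableAt (by simp)).hasFDerivAt.comp_hasDerivAt
      (f := fun t : ℝ => (t, (B y).2)) (B y).1 ((hasDerivAt_id _).prodMk (hasDerivAt_const _ _))
    rw [hT, hB2, ← h2.unique hy']
    simp [stdVec]
  have hT0 : ∀ a, T 0 a = planeIncl (a 2 • w 0 + a 0 • τ) + a 1 • stdVec 1 := by
    intro a
    rw [hT, hB0, hB, show (0 : ℝ × ℝ × ℝ) = (0, 0) from rfl,
      fderiv_flow_zero hΦ.self_of_nhds hΦ0 hΦw.self_of_nhds]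
  have hTinj : ∀ a, T 0 a = 0 → a = 0 := by
    intro a ha
    rw [hT0] at ha
    have c0 := congrArg (fun v : E3 => v 0) ha
    have c1 := congrArg (fun v : E3 => v 1) ha
    have c2 := congrArg (fun v : E3 => v 2) ha
    simp [stdVec, w, τ] at c0 c1 c2
    have hN0 := hN 0 h0t
    field_simp at c0 c2
    have ha2 : a 2 = 0 := by
      have : a 2 * (G 1 0 0 ^ 2 + G 1 2 0 ^ 2) = 0 := by
        linear_combination G 1 0 0 * c2 - G 1 2 0 * c0
      exact (mul_eq_zero.1 this).resolve_right hU0.ne'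
    have ha0 : a 0 = 0 := by
      have : a 0 * (G 1 0 0 ^ 2 + G 1 2 0 ^ 2) * N 0 = 0 := by
        linear_combination G 1 0 0 * c0 + G 1 2 0 * c2
      exact (mul_eq_zero.1 ((mul_eq_zero.1 this).resolve_right hN0)).resolve_right hU0.ne'
    rw [← sum_stdVec a, ha0, ha2, c1]
    simp
  have hΨc : Tendsto Ψ (𝓝 0) (𝓝 0) := by
    have := hΨs.self_of_nhds.continuousAt
    rwa [ContinuousAt, hΨ0] at this
  have hcube_nhds : ∀ᶠ y : E3 in 𝓝 0, ∀ k, |y k| < r := by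
    rw [eventually_all]
    intro k
    have hc : Continuous fun y : E3 => |y k| := by fun_prop
    exact hc.continuousAt.eventually_lt continuousAt_const (by simpa using hr)
  obtain ⟨φ', hφ', hm', hm0', had', h⟩ := exists_adapted_chart_of_localDiffeo (ν := ν) hφ had hm hm0
    hΨs hΨ0 (hΨd 0 (by rw [hB0]; exact hΦ.self_of_nhds)) hTinj
    (by
      filter_upwards [hBc.eventually hΦ] with y hy
      rw [(hΨd y hy).fderiv, hT1])
    ((hBc.eventually hΦ).and (hT2.and (hΨc.eventually hcube_nhds)))
  have h0t' : (0 : E3) ∈ φ'.target := by rw [← hm0']; exact φ'.map_source hm'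
  refine ⟨φ', hφ', hm', hm0', had', fun y hy => ?_, ?_⟩
  · obtain ⟨hΨy, ⟨hyΦ, hy2, hyc⟩, hmet, hvol⟩ := h y hy
    simp only [hmet, hvol]
    have hfd := (hΨd y hyΦ).fderiv
    rw [hfd, hT1, hy2]
    set z := Ψ y
    have hz : planeIncl (z 0, z 2) = planeIncl (Φ (B y)) := by
      simp [z, Ψ, planeIncl_apply, stdVec]
    have hwz : w (Φ (B y)) = (-G 1 2 z / N z, G 1 0 z / N z) := by
      simp only [w]
      rw [hGinv 1 2 z hyc, hGinv 1 0 z hyc, hNinv z hyc, hz]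
    have hNz := hN z hΨy
    have e1 := hG11 z hΨy
    have e2 := hGsymm 0 1 z
    have e3 := hGsymm 2 0 z
    have e4 := hGsymm 2 1 z
    have e5 := hNsq z hΨy
    rw [hwz, planeIncl_apply]
    refine ⟨?_, ?_, ?_⟩
    · simp only [coordMetric_add_right, coordMetric_smul_right]
      change -G 1 2 z / N z * G 1 0 z + G 1 0 z / N z * G 1 2 z = 0
      ring
    · simp only [coordMetric_add_right, coordMetric_smul_right, coordMetric_add_left,
        coordMetric_smul_left]
      change -G 1 2 z / N z * (-G 1 2 z / N z * G 0 0 z + G 1 0 z / N z * G 2 0 z) +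
        G 1 0 z / N z * (-G 1 2 z / N z * G 0 2 z + G 1 0 z / N z * G 2 2 z) = 1
      rw [e3]
      field_simp
      linear_combination -e5
    · generalize T y (stdVec 0) = b
      have v1 : coordVolume ν φ (stdVec 1) (stdVec 0) (stdVec 2) z = -N z :=
        coordVolume_swap_left ..
      have v2 : coordVolume ν φ (stdVec 1) (stdVec 2) (stdVec 0) z = N z := by
        rw [coordVolume_swap_right, v1, neg_neg]
      rw [← sum_stdVec b, coordVolume_swap_right]
      simp only [coordMetric_add_right, coordMetric_smul_right, coordVolume_add_mid,
        coordVolume_smul_mid]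
      simp only [coordVolume_swap_right ν φ (stdVec 1) (_ + _), coordVolume_add_mid,
        coordVolume_smul_mid, coordVolume_self_outer, coordVolume_self_right, v1, v2]
      change _ = b 0 * G 1 0 z + b 1 * G 1 1 z + b 2 * G 1 2 z
      rw [e1]
      field_simp
      ring
  · obtain ⟨-, ⟨hyΦ, -, -⟩, hmet, -⟩ := h 0 h0t'
    have hB0' : B (stdVec 0) = (0, τ) := by rw [hB]; simp [stdVec]
    rw [hmet, (hΨd 0 hyΦ).fderiv, hT1, hΨ0, hT0]
    simp only [coordMetric_add_right, coordMetric_smul_right, planeIncl_apply]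
    have e := hG11 0 h0t
    simp only [G, τ] at e hU0 ⊢
    rw [e]
    simp [stdVec] at hU0 ⊢
    nlinarith

end NormalForm

/-! ### A shear removing the component `g_uz`. -/

section Shear

open Filter Topology VectorField

variable {M : Type*} [TopologicalSpace M] [ChartedSpace E3 M] [IsManifold (𝓡 3) ∞ M]
  {g : BilinField M} {ν : ThreeForm M} {u : OneForm M} {f : M → ℝ}

theorem fderiv_integral_param {b : ℝ × ℝ → ℝ} (hb : ContDiff ℝ ∞ b) (p : ℝ × ℝ) :
    fderiv ℝ (fun p : ℝ × ℝ => ∫ s in (0 : ℝ)..p.2, b (p.1, s)) p (0, 1) = b p := by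
  have hk := ((contDiff_integral_param hb).differentiable (by simp) p).hasFDerivAt
  have h1 := hk.comp_hasDerivAt (f := fun t : ℝ => (p.1, t)) p.2
    ((hasDerivAt_const p.2 p.1).prodMk (hasDerivAt_id p.2))
  have hc : Continuous fun s => b (p.1, s) := hb.continuous.comp (by fun_prop)
  exact h1.unique (hc.integral_hasStrictDerivAt 0 p.2).hasDerivAt

theorem eventually_abs_lt {r : ℝ} (hr : 0 < r) : ∀ᶠ y : E3 in 𝓝 0, ∀ k, |y k| < r := by
  rw [eventually_all]
  intro k
  have hc : Continuous fun y : E3 => |y k| := by fun_prop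
  exact hc.continuousAt.eventually_lt continuousAt_const (by simpa using hr)

/-- The projection to the plane with coordinates `x_u, z`. -/
noncomputable def planeProj : E3 →L[ℝ] ℝ × ℝ := (dCoord 0).prod (dCoord 2)

theorem planeProj_apply (y : E3) : planeProj y = (y 0, y 2) := rfl

theorem tendsto_planeIncl : Tendsto planeIncl (𝓝 0) (𝓝 0) := by
  have := planeIncl.continuous.continuousAt (x := 0)
  rwa [ContinuousAt, map_zero] at this

theorem tendsto_planeProj : Tendsto planeProj (𝓝 0) (𝓝 0) := by
  have := planeProj.continuous.continuousAt (x := 0)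
  rwa [ContinuousAt, map_zero] at this

/-- Around every point there is an adapted chart in which the metric has the form
`H dx_u ⊗ dx_u + G dx_u ⊙ dx_v + dz ⊗ dz`. -/
theorem exists_diagonal_adapted_chart (hst : IsSkewTorsion g ν u f) (m : M) :
    ∃ φ ∈ IsManifold.maximalAtlas (𝓡 3) ∞ M, m ∈ φ.source ∧ φ m = 0 ∧ IsAdapted g u φ ∧
      ∀ y ∈ φ.target, coordMetric g φ (stdVec 1) (stdVec 2) y = 0 ∧
        coordMetric g φ (stdVec 2) (stdVec 2) y = 1 ∧
        coordMetric g φ (stdVec 0) (stdVec 2) y = 0 ∧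
        coordVolume ν φ (stdVec 1) (stdVec 2) (stdVec 0) y =
          coordMetric g φ (stdVec 1) (stdVec 0) y ∧
        0 < coordMetric g φ (stdVec 1) (stdVec 0) y := by
  obtain ⟨S⟩ := hst.stronglySpin.spin
  have hg := hst.stronglySpin.lorentz
  obtain ⟨φ, hφ, hm, hm0, had, hφ2, hpos⟩ := exists_orthogonal_adapted_chart hst m
  have h0t : (0 : E3) ∈ φ.target := by rw [← hm0]; exact φ.map_source hm
  let G : Fin 3 → Fin 3 → E3 → ℝ := fun i j => coordMetric g φ (stdVec i) (stdVec j)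
  have hGs : ∀ i j, ∀ y ∈ φ.target, ContDiffAt ℝ ∞ (G i j) y := fun i j y hy =>
    contDiffAt_coordMetric hg hφ _ _ hy
  obtain ⟨r, hr, hcube⟩ := exists_cube_subset (φ.open_target.mem_nhds h0t)
  have hGinv : ∀ i j (y : E3), (∀ k, |y k| < r) → G i j y = G i j (planeIncl (y 0, y 2)) :=
    fun i j y hy => eq_planeIncl_of_fderiv_eq_zero
      (fun z hz => (hGs i j z (hcube z hz)).differentiableAt (by simp))
      (fun z hz => (had.structure_equations hst hφ (hcube z hz) _ _).1) hy
  have hGpos : ∀ᶠ y in 𝓝 0, 0 < G 1 0 y :=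
    continuousAt_const.eventually_lt (hGs 1 0 0 h0t).continuousAt hpos
  -- The shear replaces `∂_z` by `∂_z - b ∂_{x_v}`, which changes `g_uz` to `g_uz - b g_uv`; hence
  -- the quotient. The components `g_vz = 0` and `g_vv = 0` keep the rest of the form intact.
  obtain ⟨b, hb, hbG⟩ := exists_contDiff_eventuallyEq (a := (0 : ℝ × ℝ))
    (f := fun q => G 0 2 (planeIncl q) / G 1 0 (planeIncl q)) (by
      filter_upwards [tendsto_planeIncl.eventually hGpos,
        tendsto_planeIncl.eventually (φ.open_target.mem_nhds h0t)] with q hq hq'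
      exact ((hGs 0 2 _ hq').comp q planeIncl.contDiff.contDiffAt).div
        ((hGs 1 0 _ hq').comp q planeIncl.contDiff.contDiffAt) hq.ne')
  let k : ℝ × ℝ → ℝ := fun p => ∫ s in (0 : ℝ)..p.2, b (p.1, s)
  have hk : ContDiff ℝ ∞ k := contDiff_integral_param hb
  let Ψ : E3 → E3 := fun y => y + (-k (planeProj y)) • stdVec 1
  let T : E3 → E3 →L[ℝ] E3 := fun y => ContinuousLinearMap.id ℝ E3 +
    (-(fderiv ℝ k (planeProj y) ∘L planeProj)).smulRight (stdVec 1)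
  have hT : ∀ y a, T y a = a + (-(fderiv ℝ k (planeProj y) (planeProj a))) • stdVec 1 :=
    fun y a => rfl
  have hΨd : ∀ y, HasFDerivAt Ψ (T y) y := fun y =>
    (hasFDerivAt_id y).add ((((hk.differentiable (by simp) _).hasFDerivAt.comp y
      planeProj.hasFDerivAt).neg).smul_const (stdVec 1))
  have hΨs : ContDiff ℝ ∞ Ψ :=
    contDiff_id.add ((hk.comp planeProj.contDiff).neg.smul contDiff_const)
  have hk0 : k 0 = 0 := by simp [k]
  have hΨ0 : Ψ 0 = 0 := by simp [Ψ, hk0]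
  have hT1 : ∀ y, T y (stdVec 1) = stdVec 1 := fun y => by
    have hp : planeProj (stdVec 1) = 0 := by rw [planeProj_apply]; simp [stdVec]
    rw [hT, hp, map_zero, neg_zero, zero_smul, add_zero]
  have hT2 : ∀ y, T y (stdVec 2) = stdVec 2 + (-b (planeProj y)) • stdVec 1 := fun y => by
    rw [hT, ← fderiv_integral_param hb]
    congr 4
  have hΨc : Tendsto Ψ (𝓝 0) (𝓝 0) := by
    have := hΨs.continuous.continuousAt (x := 0)
    rwa [ContinuousAt, hΨ0] at this
  have hΨp : ∀ y, planeProj (Ψ y) = planeProj y := fun y => by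
    simp [Ψ, planeProj_apply, stdVec]
  obtain ⟨φ', hφ', hm', hm0', had', h⟩ := exists_adapted_chart_of_localDiffeo (ν := ν) hφ had hm hm0
    (Eventually.of_forall fun y => hΨs.contDiffAt) hΨ0 (hΨd 0)
    (by
      intro a ha
      have c0 := congrArg (fun v : E3 => v 0) ha
      have c2 := congrArg (fun v : E3 => v 2) ha
      simp [hT, stdVec] at c0 c2
      have hp : planeProj a = 0 := by rw [planeProj_apply, c0, c2]; rfl
      rwa [hT, hp, map_zero, neg_zero, zero_smul, add_zero] at ha)
    (Eventually.of_forall fun y => by rw [(hΨd y).fderiv, hT1])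
    ((tendsto_planeProj.eventually hbG).and
      ((hΨc.eventually (eventually_abs_lt hr)).and (hΨc.eventually hGpos)))
  refine ⟨φ', hφ', hm', hm0', had', fun y hy => ?_⟩
  obtain ⟨hΨy, ⟨hby, hyc, hyp⟩, hmet, hvol⟩ := h y hy
  obtain ⟨e12, e22, hv⟩ := hφ2 _ hΨy
  have e11 := had.coordMetric_one_one S hst.isotropic hΨy
  have hbz : b (planeProj y) * G 1 0 (Ψ y) = G 0 2 (Ψ y) := by
    rw [hGinv 0 2 _ hyc, hGinv 1 0 _ hyc, hby]
    have h1 := hΨp y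
    rw [planeProj_apply] at h1
    rw [h1]
    rw [hGinv 1 0 _ hyc, h1] at hyp
    field_simp
  simp only [hmet, hvol, (hΨd y).fderiv, hT1, hT2]
  rw [hT y (stdVec 0)]
  generalize -(fderiv ℝ k (planeProj y) (planeProj (stdVec 0))) = d
  simp only [coordMetric_add_right, coordMetric_add_left, coordMetric_smul_left,
    coordMetric_smul_right, coordVolume_add_mid, coordVolume_smul_mid, coordVolume_self_left,
    coordVolume_swap_right ν φ (stdVec 1) (_ + _) (stdVec 2)]
  have e21 := coordMetric_symm (φ := φ) hg (stdVec 2) (stdVec 1) (Ψ y)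
  have e01 := coordMetric_symm (φ := φ) hg (stdVec 0) (stdVec 1) (Ψ y)
  simp only [G] at hbz hyp
  rw [e21, e01, e11, e12, e22, ← hbz]
  have hs := coordVolume_swap_right ν φ (stdVec 1) (stdVec 2) (stdVec 0) (Ψ y)
  refine ⟨by ring, by ring, by ring, ?_, by linarith⟩
  linarith

end Shear

/-! ### Integration of `∂_z E = 2 f E` and the local normal form. -/

section LocalNormalForm

open Filter Topology VectorField

variable {M : Type*} [TopologicalSpace M] [ChartedSpace E3 M] {g : BilinField M}
  {φ : OpenPartialHomeomorph M E3}

theorem metric_eq_coordMetric (hφ : φ ∈ IsManifold.maximalAtlas (𝓡 3) ∞ M) {x : M}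
    (hx : x ∈ φ.source) (v w : TangentSpace (𝓡 3) x) :
    g x v w = coordMetric g φ (mfderiv (𝓡 3) (𝓡 3) φ x v) (mfderiv (𝓡 3) (𝓡 3) φ x w) (φ x) := by
  have key : ∀ a b : E3, coordField φ a x = v → coordField φ b x = w →
      g x v w = coordMetric g φ a b (φ x) := by
    rintro a b rfl rfl
    rw [coordMetric, φ.left_inv hx]
  exact key _ _ (coordField_mfderiv hφ hx v) (coordField_mfderiv hφ hx w)

theorem modelMetricAt_apply (f H : ℝ × ℝ → ℝ) (c : ℝ → ℝ) (p a b : E3) :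
    modelMetricAt f H c p a b = H (p 0, p 2) * (a 0 * b 0) +
      Real.exp (exponent f c p) * (a 0 * b 1 + a 1 * b 0) + a 2 * b 2 := by
  simp only [modelMetricAt, dCoord, add_apply, smul_apply, ContinuousLinearMap.smulRight_apply,
    smul_eq_mul]
  rfl

theorem modelFormAt_apply (f : ℝ × ℝ → ℝ) (c : ℝ → ℝ) (p a : E3) :
    modelFormAt f c p a = Real.exp (exponent f c p) * a 0 := rfl

variable [IsManifold (𝓡 3) ∞ M] {ν : ThreeForm M} {u : OneForm M} {f : M → ℝ}

/-- Since `g_vz = 0` and `ν(∂_v, ∂_z, ∂_u) = E = g_uv`, the equation `du = 2 f *u` on `(∂_z, ∂_u)`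
is `∂_z E = 2 f E`. -/
theorem IsAdapted.exists_normal_form (had : IsAdapted g u φ) (hst : IsSkewTorsion g ν u f)
    (hφ : φ ∈ IsManifold.maximalAtlas (𝓡 3) ∞ M) (h0t : 0 ∈ φ.target)
    (h : ∀ y ∈ φ.target, coordMetric g φ (stdVec 1) (stdVec 2) y = 0 ∧
        coordMetric g φ (stdVec 2) (stdVec 2) y = 1 ∧
        coordMetric g φ (stdVec 0) (stdVec 2) y = 0 ∧
        coordVolume ν φ (stdVec 1) (stdVec 2) (stdVec 0) y =
          coordMetric g φ (stdVec 1) (stdVec 0) y ∧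
        0 < coordMetric g φ (stdVec 1) (stdVec 0) y) :
    ∃ (f' H : ℝ × ℝ → ℝ) (c : ℝ → ℝ), ContDiff ℝ ∞ f' ∧ ContDiff ℝ ∞ H ∧ ContDiff ℝ ∞ c ∧
      ∀ᶠ y in 𝓝 0, y ∈ φ.target ∧ f (φ.symm y) = f' (y 0, y 2) ∧
        coordMetric g φ (stdVec 0) (stdVec 0) y = H (y 0, y 2) ∧
        coordMetric g φ (stdVec 1) (stdVec 0) y = Real.exp (exponent f' c y) := by
  have hg := hst.stronglySpin.lorentz
  have hGs : ∀ a b, ∀ y ∈ φ.target, ContDiffAt ℝ ∞ (coordMetric g φ a b) y := fun a b y hy =>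
    contDiffAt_coordMetric hg hφ _ _ hy
  obtain ⟨r, hr, hcube⟩ := exists_cube_subset (φ.open_target.mem_nhds h0t)
  have hGinv : ∀ a b (y : E3), (∀ k, |y k| < r) →
      coordMetric g φ a b y = coordMetric g φ a b (planeIncl (y 0, y 2)) :=
    fun a b y hy => eq_planeIncl_of_fderiv_eq_zero
      (fun z hz => (hGs a b z (hcube z hz)).differentiableAt (by simp))
      (fun z hz => (had.structure_equations hst hφ (hcube z hz) _ _).1) hy
  set E : E3 → ℝ := coordMetric g φ (stdVec 1) (stdVec 0) with hE
  have hfE : ∀ y ∈ φ.target, fderiv ℝ E y (stdVec 2) = 2 * f (φ.symm y) * E y := by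
    intro y hy
    have h1 := (had.structure_equations hst hφ hy (stdVec 2) (stdVec 0)).2
    have h2 : coordMetric g φ (stdVec 1) (stdVec 2) =ᶠ[𝓝 y] fun _ => 0 := by
      filter_upwards [φ.open_target.mem_nhds hy] with z hz using (h z hz).1
    rw [h2.fderiv_eq, (h y hy).2.2.2.1] at h1
    simpa using h1
  have hpp : ∀ y : E3, (∀ k, |y k| < r) → ∀ k, |planeIncl (y 0, y 2) k| < r := by
    intro y hy k
    fin_cases k
    · simpa using hy 0
    · simpa using hr
    · simpa using hy 2
  -- `f = ∂_z E / (2 E)`, and `E` is independent of `x_v`.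
  have hfinv : ∀ y : E3, (∀ k, |y k| < r) → f (φ.symm y) = f (φ.symm (planeIncl (y 0, y 2))) := by
    intro y hy
    have hEe : E =ᶠ[𝓝 y] fun z => E (planeIncl (planeProj z)) := by
      have hop : IsOpen {z : E3 | ∀ k, |z k| < r} := by
        simp only [ofPred_forall]
        exact isOpen_iInter_of_finite fun k => isOpen_lt (by fun_prop) continuous_const
      filter_upwards [hop.mem_nhds hy] with z hz using hGinv _ _ z hz
    have hy' := hcube _ (hpp y hy)
    have h1 := ((hGs (stdVec 1) (stdVec 0) _ hy').differentiableAt (by simp)).hasFDerivAt.comp y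
      (planeIncl ∘L planeProj).hasFDerivAt (f := fun z => planeIncl (planeProj z))
    have h2 := (h1.congr_of_eventuallyEq hEe).fderiv
    have h3 := hfE y (hcube y hy)
    have h4 := hfE _ hy'
    have h5 : planeIncl (planeProj (stdVec 2)) = stdVec 2 := by
      simp [planeProj_apply, planeIncl_apply, stdVec]
    have h6 : E y = E (planeIncl (y 0, y 2)) := hGinv _ _ y hy
    rw [h2, ContinuousLinearMap.comp_apply, ContinuousLinearMap.comp_apply, h5, h6] at h3
    replace h3 := h4.symm.trans h3
    have hpos := (h _ hy').2.2.2.2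
    have := mul_right_cancel₀ hpos.ne' h3
    linarith
  have hev : ∀ᶠ q in 𝓝 (0 : ℝ × ℝ), planeIncl q ∈ φ.target :=
    tendsto_planeIncl.eventually (φ.open_target.mem_nhds h0t)
  obtain ⟨f', hf', hf'e⟩ := exists_contDiff_eventuallyEq (a := (0 : ℝ × ℝ))
    (f := fun q => f (φ.symm (planeIncl q))) (by
      filter_upwards [hev] with q hq
      exact (contDiffAt_comp_symm hφ hq (hst.smooth_f _)).comp q planeIncl.contDiff.contDiffAt)
  obtain ⟨H, hH, hHe⟩ := exists_contDiff_eventuallyEq (a := (0 : ℝ × ℝ))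
    (f := fun q => coordMetric g φ (stdVec 0) (stdVec 0) (planeIncl q)) (by
      filter_upwards [hev] with q hq
      exact (hGs _ _ _ hq).comp q planeIncl.contDiff.contDiffAt)
  have hax : Tendsto (fun x : ℝ => (x, (0 : ℝ))) (𝓝 0) (𝓝 0) := by
    have : Continuous fun x : ℝ => (x, (0 : ℝ)) := by fun_prop
    exact this.continuousAt (x := 0)
  -- `exponent` uses the primitive vanishing at `z = 0`, so `c` must be `log E` on the axis `z = 0`.
  obtain ⟨c, hc, hce⟩ := exists_contDiff_eventuallyEq (a := (0 : ℝ))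
    (f := fun x => Real.log (E (planeIncl (x, 0)))) (by
      filter_upwards [hax.eventually hev] with x hx
      exact (((hGs _ _ _ hx).comp (x, (0 : ℝ)) planeIncl.contDiff.contDiffAt).log
        (h _ hx).2.2.2.2.ne').comp x (contDiffAt_id.prodMk contDiffAt_const))
  refine ⟨f', H, c, hf', hH, hc, ?_⟩
  have hfst : Tendsto (Prod.fst : ℝ × ℝ → ℝ) (𝓝 0) (𝓝 0) := continuous_fst.continuousAt (x := 0)
  obtain ⟨ε, hε, hb⟩ := Metric.eventually_nhds_iff_ball.1
    ((hf'e.and hHe).and ((hfst.eventually hce).and hev))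
  have hball : ∀ x z : ℝ, |x| < ε → |z| < ε → (x, z) ∈ Metric.ball (0 : ℝ × ℝ) ε := by
    intro x z hx hz
    rw [mem_ball_zero_iff, Prod.norm_mk]
    exact max_lt hx hz
  filter_upwards [eventually_abs_lt hr, eventually_abs_lt hε] with y hyr hyε
  obtain ⟨⟨q1, q2⟩, q3, q4⟩ := hb _ (hball _ _ (hyε 0) (hyε 2))
  refine ⟨hcube y hyr, (hfinv y hyr).trans q1.symm, (hGinv _ _ y hyr).trans q2.symm, ?_⟩
  have hEp : ∀ q, planeIncl q ∈ φ.target → 0 < E (planeIncl q) := fun q hq => (h _ hq).2.2.2.2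
  -- The equation for `E` in logarithmic form: `∂_z log E = 2 f`.
  have hint : ∫ s in (0 : ℝ)..(y 2), 2 * f' (y 0, s) =
      Real.log (E (planeIncl (y 0, y 2))) - Real.log (E (planeIncl (y 0, 0))) := by
    refine intervalIntegral.integral_eq_sub_of_hasDerivAt
      (f := fun s => Real.log (E (planeIncl (y 0, s)))) ?_ ?_
    · intro s hs
      have hsε : |s| < ε := by
        refine lt_of_le_of_lt ?_ (hyε 2)
        have := abs_sub_left_of_mem_uIcc hs
        simpa using this
      obtain ⟨⟨p1, -⟩, -, p4⟩ := hb _ (hball _ _ (hyε 0) hsε)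
      have hline : HasDerivAt (fun s : ℝ => planeIncl (y 0, s)) (stdVec 2) s := by
        have := planeIncl.hasFDerivAt.comp_hasDerivAt (f := fun s : ℝ => (y 0, s)) s
          ((hasDerivAt_const s (y 0)).prodMk (hasDerivAt_id s))
        rwa [show planeIncl (0, 1) = stdVec 2 by simp [planeIncl_apply]] at this
      have hd := ((hGs (stdVec 1) (stdVec 0) _ p4).differentiableAt
        (by simp)).hasFDerivAt.comp_hasDerivAt s hline
      have hval : 2 * f' (y 0, s) =
          fderiv ℝ E (planeIncl (y 0, s)) (stdVec 2) / E (planeIncl (y 0, s)) := by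
        rw [p1, eq_div_iff (hEp _ p4).ne']
        exact (hfE _ p4).symm
      rw [hval]
      exact HasDerivAt.log (f := fun s => E (planeIncl (y 0, s))) hd (hEp _ p4).ne'
    · have : Continuous fun s => 2 * f' (y 0, s) :=
        continuous_const.mul (hf'.continuous.comp (by fun_prop))
      exact this.intervalIntegrable _ _
  rw [intervalIntegral.integral_const_mul] at hint
  rw [exponent, hint, q3, sub_add_cancel, Real.exp_log (hEp _ q4)]
  exact hGinv _ _ y hyr

/-- The local normal form of skew-torsion Lorentzian three-manifolds. -/
theorem IsSkewTorsion.exists_normal_form (hst : IsSkewTorsion g ν u f) (m : M) :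
    ∃ φ ∈ IsManifold.maximalAtlas (𝓡 3) ∞ M, m ∈ φ.source ∧
      ∃ (f' H : ℝ × ℝ → ℝ) (c : ℝ → ℝ), ContDiff ℝ ∞ f' ∧ ContDiff ℝ ∞ H ∧ ContDiff ℝ ∞ c ∧
        ∀ x ∈ φ.source, f x = f' (φ x 0, φ x 2) ∧
          (∀ v w : TangentSpace (𝓡 3) x, g x v w = modelMetric f' H c (φ x)
            (mfderiv (𝓡 3) (𝓡 3) φ x v) (mfderiv (𝓡 3) (𝓡 3) φ x w)) ∧
          (∀ v : TangentSpace (𝓡 3) x,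
            u x v = modelForm f' c (φ x) (mfderiv (𝓡 3) (𝓡 3) φ x v)) := by
  obtain ⟨S⟩ := hst.stronglySpin.spin
  have hg := hst.stronglySpin.lorentz
  obtain ⟨φ, hφ, hm, hm0, had, h⟩ := exists_diagonal_adapted_chart hst m
  have h0t : (0 : E3) ∈ φ.target := by rw [← hm0]; exact φ.map_source hm
  obtain ⟨f', H, c, hf', hH, hc, hev⟩ := had.exists_normal_form hst hφ h0t h
  have hcont := φ.continuousAt hm
  rw [ContinuousAt, hm0] at hcont
  obtain ⟨s, hsub, hso, hms⟩ := mem_nhds_iff.1 (hcont.eventually hev)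
  refine ⟨φ.restr s, restr_mem_maximalAtlas _ hφ hso, ?_, f', H, c, hf', hH, hc, ?_⟩
  · rw [φ.restr_source, hso.interior_eq]
    exact ⟨hm, hms⟩
  intro x hx
  rw [φ.restr_source, hso.interior_eq] at hx
  obtain ⟨hxs, hx⟩ := hx
  obtain ⟨hy, hf, h00, h10⟩ := hsub hx
  rw [φ.left_inv hxs] at hf
  obtain ⟨h12, h22, h02, -, -⟩ := h _ hy
  have h11 := had.coordMetric_one_one S hst.isotropic hy
  have e21 := coordMetric_symm (φ := φ) hg (stdVec 2) (stdVec 1) (φ x)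
  have e01 := coordMetric_symm (φ := φ) hg (stdVec 0) (stdVec 1) (φ x)
  have e20 := coordMetric_symm (φ := φ) hg (stdVec 2) (stdVec 0) (φ x)
  rw [h12] at e21
  rw [h10] at e01
  rw [h02] at e20
  refine ⟨hf, fun v w => ?_, fun v => ?_⟩
  · refine (metric_eq_coordMetric hφ hxs v w).trans ((?_ : ∀ a b : E3, coordMetric g φ a b (φ x) =
      modelMetricAt f' H c (φ x) a b) _ _)
    intro a b
    rw [modelMetricAt_apply]
    conv_lhs => rw [← sum_stdVec a, ← sum_stdVec b]
    simp only [coordMetric_add_left, coordMetric_add_right, coordMetric_smul_left,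
      coordMetric_smul_right, h00, h10, h12, h22, h02, h11, e21, e01, e20]
    ring
  · have key : ∀ a : E3, coordField φ a x = v → u x v = coordMetric g φ (stdVec 1) a (φ x) := by
      rintro a rfl
      rw [← had.form_apply S hy, φ.left_inv hxs]
    refine (key _ (coordField_mfderiv hφ hxs v)).trans ((?_ : ∀ a : E3, coordMetric g φ (stdVec 1) a (φ x) =
      modelFormAt f' c (φ x) a) _)
    intro a
    rw [modelFormAt_apply]
    conv_lhs => rw [← sum_stdVec a]
    simp only [coordMetric_add_right, coordMetric_smul_right, h10, h12, h11]
    ring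

end LocalNormalForm

/-! ### Tensor fields on `ℝ³` and the Levi-Civita connection by Christoffel symbols. -/

section FlatSpace

set_option synthInstance.maxHeartbeats 200000

open Filter Topology VectorField

/-- The tangent trivializations of the model space are identities, so smoothness of bundle sections
reduces to ordinary smoothness. -/
theorem trivializationAt_cotangent_apply (x y : E3) (α : TangentSpace (𝓡 3) y →L[ℝ] ℝ) (v : E3) :
    (trivializationAt (E3 →L[ℝ] ℝ)
      (fun x : E3 => TangentSpace (𝓡 3) x →L[ℝ] ℝ) x ⟨y, α⟩).2 v = α v := by
  have h1 := TangentBundle.symmL_model_space (𝕜 := ℝ) x y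
  have h2 := Bundle.Trivial.continuousLinearMapAt_trivialization ℝ E3 ℝ y
  rw [hom_trivializationAt_apply]
  exact (DFunLike.congr_fun h2 _).trans (congrArg α (DFunLike.congr_fun h1 v))

theorem smoothOneForm_of_contDiff {u : OneForm E3}
    (hu : ContDiff (E := E3) (F := E3 →L[ℝ] ℝ) ℝ ∞ u) : SmoothOneForm u := by
  intro x
  refine (contMDiffAt_section _).2 ?_
  have key : ∀ y, (trivializationAt (E3 →L[ℝ] ℝ)
      (fun x : E3 => TangentSpace (𝓡 3) x →L[ℝ] ℝ) x ⟨y, u y⟩).2 = (u y : E3 →L[ℝ] ℝ) := by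
    intro y
    ext v
    exact trivializationAt_cotangent_apply x y (u y) v
  exact (hu.contDiffAt.contMDiffAt (x := x)).congr_of_eventuallyEq (Eventually.of_forall key)

theorem contMDiff_of_contDiff {g : BilinField E3}
    (hg : ContDiff (E := E3) (F := E3 →L[ℝ] E3 →L[ℝ] ℝ) ℝ ∞ g) :
    ContMDiff (𝓡 3) ((𝓡 3).prod 𝓘(ℝ, E3 →L[ℝ] E3 →L[ℝ] ℝ)) ∞
    (fun x => (TotalSpace.mk' (E3 →L[ℝ] E3 →L[ℝ] ℝ) x (g x) :
      TotalSpace (E3 →L[ℝ] E3 →L[ℝ] ℝ)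
        (fun x : E3 => TangentSpace (𝓡 3) x →L[ℝ] TangentSpace (𝓡 3) x →L[ℝ] ℝ))) := by
  intro x
  refine (contMDiffAt_section _).2 ?_
  have key : ∀ y, (trivializationAt (E3 →L[ℝ] E3 →L[ℝ] ℝ)
      (fun x : E3 => TangentSpace (𝓡 3) x →L[ℝ] TangentSpace (𝓡 3) x →L[ℝ] ℝ) x ⟨y, g y⟩).2 =
        (g y : E3 →L[ℝ] E3 →L[ℝ] ℝ) := by
    intro y
    rw [hom_trivializationAt_apply]
    have h1 := TangentBundle.symmL_model_space (𝕜 := ℝ) x y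
    ext v w
    rw [ContinuousLinearMap.inCoordinates, ContinuousLinearMap.comp_apply,
      Trivialization.continuousLinearMapAt_apply, Trivialization.linearMapAt_apply, if_pos (by simp [chartAt_self_eq])]
    refine (trivializationAt_cotangent_apply x y _ w).trans ?_
    exact congrArg (fun a => g y a w) (DFunLike.congr_fun h1 v)
  exact (hg.contDiffAt.contMDiffAt (x := x)).congr_of_eventuallyEq (Eventually.of_forall key)

theorem smoothVFieldOn_univ {X : E3 → E3} (hX : ContDiff ℝ ∞ X) :
    SmoothVFieldOn (M := E3) X univ := fun _ _ =>
  (contMDiffAt_vectorSpace_iff_contDiffAt (V := X).2 hX.contDiffAt).contMDiffWithinAt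

theorem differentiableAt_of_mdifferentiableAt {X : VField E3} {x : E3}
    (hX : MDifferentiableAt (𝓡 3) ((𝓡 3).prod 𝓘(ℝ, E3))
      (fun y => (TotalSpace.mk' E3 y (X y) : TangentBundle (𝓡 3) E3)) x) :
    DifferentiableAt ℝ (fun y => (X y : E3)) x := by
  have h := (mdifferentiableAt_section _ X).1 hX
  rw [mdifferentiableAt_iff_differentiableAt] at h
  convert! h using 2 with y
  simp [TangentSpace]

theorem mlieBracket_eq_fderiv (X Y : E3 → E3) (x : E3) :
    mlieBracket (𝓡 3) (X : VField E3) (Y : VField E3) x = fderiv ℝ Y x (X x) - fderiv ℝ X x (Y x) :=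
  (congrFun (mlieBracketWithin_univ (I := 𝓡 3) (V := X) (W := Y)) x).symm.trans
    ((congrFun (mlieBracketWithin_eq_lieBracketWithin (V := X) (W := Y) (s := univ)) x).trans
      (by rw [lieBracketWithin_univ]; rfl))

/-- The Christoffel symbols of the first kind of a field of bilinear forms on `ℝ³`. -/
noncomputable def christoffel (g : E3 → E3 →L[ℝ] E3 →L[ℝ] ℝ) (x Y : E3) :
    E3 →L[ℝ] E3 →L[ℝ] ℝ :=
  (1 / 2 : ℝ) • ((fderiv ℝ g x).flip Y + fderiv ℝ g x Y - ((fderiv ℝ g x).flip Y).flip)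

theorem christoffel_apply (g : E3 → E3 →L[ℝ] E3 →L[ℝ] ℝ) (x Y v w : E3) :
    christoffel g x Y v w =
      1 / 2 * (fderiv ℝ g x v Y w + fderiv ℝ g x Y v w - fderiv ℝ g x w Y v) := rfl

theorem fderiv_bilin_symm {g : E3 → E3 →L[ℝ] E3 →L[ℝ] ℝ} (hs : ∀ x v w, g x v w = g x w v)
    (hg : Differentiable ℝ g) (x a v w : E3) : fderiv ℝ g x a v w = fderiv ℝ g x a w v := by
  have h := fun v w => (((hg x).hasFDerivAt.clm_apply (hasFDerivAt_const v x)).clm_apply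
    (hasFDerivAt_const w x))
  have h1 := (h v w).unique ((h w v).congr_of_eventuallyEq (Eventually.of_forall fun y => hs y v w))
  simpa using DFunLike.congr_fun h1 a

/-- The covariant derivative on `ℝ³` with the Christoffel symbols of `g`, where `R` inverts `g`. -/
noncomputable def flatCovDeriv (g : E3 → E3 →L[ℝ] E3 →L[ℝ] ℝ) (R : E3 → (E3 →L[ℝ] ℝ) →L[ℝ] E3)
    (Y : E3 → E3) (x : E3) : E3 →L[ℝ] E3 :=
  fderiv ℝ Y x + R x ∘L christoffel g x (Y x)

theorem flatCovDeriv_apply (g : E3 → E3 →L[ℝ] E3 →L[ℝ] ℝ) (R : E3 → (E3 →L[ℝ] ℝ) →L[ℝ] E3)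
    (Y : E3 → E3) (x v : E3) :
    flatCovDeriv g R Y x v = fderiv ℝ Y x v + R x (christoffel g x (Y x) v) := rfl

theorem christoffel_add (g : E3 → E3 →L[ℝ] E3 →L[ℝ] ℝ) (x Y Z : E3) :
    christoffel g x (Y + Z) = christoffel g x Y + christoffel g x Z := by
  ext v w
  simp only [christoffel_apply, map_add, add_apply]
  ring

theorem christoffel_smul (g : E3 → E3 →L[ℝ] E3 →L[ℝ] ℝ) (x Y : E3) (r : ℝ) :
    christoffel g x (r • Y) = r • christoffel g x Y := by
  ext v w
  simp only [christoffel_apply, map_smul, smul_apply, smul_eq_mul]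
  ring

theorem flatCovDeriv_add (g : E3 → E3 →L[ℝ] E3 →L[ℝ] ℝ) (R : E3 → (E3 →L[ℝ] ℝ) →L[ℝ] E3)
    {Y Z : E3 → E3} {x : E3} (hY : DifferentiableAt ℝ Y x) (hZ : DifferentiableAt ℝ Z x) :
    flatCovDeriv g R (Y + Z) x = flatCovDeriv g R Y x + flatCovDeriv g R Z x := by
  ext1 v
  simp only [flatCovDeriv_apply, fderiv_add hY hZ, Pi.add_apply, christoffel_add, add_apply,
    map_add]
  abel

theorem flatCovDeriv_smul (g : E3 → E3 →L[ℝ] E3 →L[ℝ] ℝ) (R : E3 → (E3 →L[ℝ] ℝ) →L[ℝ] E3)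
    {h : E3 → ℝ} {Y : E3 → E3} {x : E3} (hh : DifferentiableAt ℝ h x)
    (hY : DifferentiableAt ℝ Y x) :
    flatCovDeriv g R (h • Y) x = h x • flatCovDeriv g R Y x + (fderiv ℝ h x).smulRight (Y x) := by
  ext1 v
  simp only [flatCovDeriv_apply, fderiv_smul hh hY, Pi.smul_apply', christoffel_smul, add_apply,
    smul_apply, map_smul, smul_add, ContinuousLinearMap.smulRight_apply]
  abel

theorem mvfderiv_eq_fderiv (h : E3 → ℝ) (x : E3) :
    (mvfderiv (𝓡 3) h x : E3 →L[ℝ] ℝ) = fderiv ℝ h x := by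
  ext1 v
  exact DFunLike.congr_fun (mfderiv_eq_fderiv (f := h) (x := x)) v

/-- The Levi-Civita connection of a metric on `ℝ³` with a given inverse. -/
noncomputable def flatLeviCivita (g : E3 → E3 →L[ℝ] E3 →L[ℝ] ℝ)
    (R : E3 → (E3 →L[ℝ] ℝ) →L[ℝ] E3) :
    CovariantDerivative (𝓡 3) E3 (TangentSpace (𝓡 3) : E3 → Type _) where
  toFun := flatCovDeriv g R
  isCovariantDerivativeOnUniv :=
    { add := fun hY hZ _ => flatCovDeriv_add g R (differentiableAt_of_mdifferentiableAt hY)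
        (differentiableAt_of_mdifferentiableAt hZ)
      leibniz := fun {Y h x} hY hh _ => by
        refine (flatCovDeriv_smul g R (mdifferentiableAt_iff_differentiableAt.1 hh)
          (differentiableAt_of_mdifferentiableAt hY)).trans ?_
        rw [← mvfderiv_eq_fderiv]
        rfl }

/-- Torsion vanishes because the Christoffel symbols are symmetric in their first two arguments. In
the metric identity `hR` cancels `g` against its inverse, and the two symbols add up to the
derivative of `g`. -/
theorem isLeviCivita_flatLeviCivita {g : E3 → E3 →L[ℝ] E3 →L[ℝ] ℝ}
    {R : E3 → (E3 →L[ℝ] ℝ) →L[ℝ] E3} (hs : ∀ x v w, g x v w = g x w v)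
    (hg : Differentiable ℝ g) (hR : ∀ x α w, g x (R x α) w = α w) :
    IsLeviCivita (M := E3) g (flatLeviCivita g R) := by
  constructor
  · rw [CovariantDerivative.torsion_eq_zero_iff]
    intro X Y x hX hY
    refine Eq.trans ?_ (mlieBracket_eq_fderiv X Y x).symm
    have h : ∀ a b : E3, christoffel g x a b = christoffel g x b a := by
      intro a b
      ext w
      rw [christoffel_apply, christoffel_apply, fderiv_bilin_symm hs hg x w b a]
      ring
    change (fderiv ℝ (Y : E3 → E3) x (X x) + R x (christoffel g x (Y x) (X x))) -
      (fderiv ℝ (X : E3 → E3) x (Y x) + R x (christoffel g x (X x) (Y x))) = _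
    rw [h (Y x) (X x)]
    abel
  · intro x Y Z hY hZ v
    have hY' := (differentiableAt_of_mdifferentiableAt hY).hasFDerivAt
    have hZ' := (differentiableAt_of_mdifferentiableAt hZ).hasFDerivAt
    have h := ((hg x).hasFDerivAt.clm_apply hY').clm_apply hZ'
    refine (DFunLike.congr_fun ((mvfderiv_eq_fderiv _ x).trans h.fderiv) v).trans ?_
    refine Eq.trans ?_ (congrArg₂ (· + ·)
      (congrArg (fun a : E3 => g x a (Z x)) (flatCovDeriv_apply g R Y x v).symm)
      (congrArg (fun a : E3 => g x (Y x) a) (flatCovDeriv_apply g R Z x v).symm))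
    have key : ∀ a b c d w : E3, fderiv ℝ g x w a b + g x c b + g x a d =
        g x (c + R x (christoffel g x a w)) b + g x a (d + R x (christoffel g x b w)) := by
      intro a b c d w
      rw [map_add, add_apply, map_add, hR, hs x a (R x _), hR, christoffel_apply,
        christoffel_apply, fderiv_bilin_symm hs hg x b a w, fderiv_bilin_symm hs hg x a b w,
        fderiv_bilin_symm hs hg x w b a]
      ring
    refine Eq.trans ?_ (key (Y x) (Z x) (fderiv ℝ Y x v) (fderiv ℝ Z x v) v)
    change g x (Y x) (fderiv ℝ (Z : E3 → E3) x v) + (g x (fderiv ℝ (Y : E3 → E3) x v) (Z x) +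
      fderiv ℝ g x v (Y x) (Z x)) = _
    ring

end FlatSpace

/-! ### The model metrics are skew-torsion, and they determine their parameters. -/

section ModelGeometry

set_option synthInstance.maxHeartbeats 200000

open Filter Topology VectorField

variable {f H : ℝ × ℝ → ℝ} {c : ℝ → ℝ}

theorem contDiff_dCoord (i : Fin 3) : ContDiff ℝ ∞ fun p : E3 => p i :=
  (dCoord i).contDiff

theorem contDiff_exponent (hf : ContDiff ℝ ∞ f) (hc : ContDiff ℝ ∞ c) :
    ContDiff ℝ ∞ (exponent f c) :=
  (contDiff_const.mul ((contDiff_integral_param hf).comp planeProj.contDiff)).add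
    (hc.comp (contDiff_dCoord 0))

theorem contDiff_smul_const {F : Type*} [NormedAddCommGroup F] [NormedSpace ℝ F] {h : E3 → ℝ}
    (hh : ContDiff ℝ ∞ h) (B : F) : ContDiff ℝ ∞ fun p => h p • B :=
  hh.smul contDiff_const

theorem contDiff_modelMetricAt (hf : ContDiff ℝ ∞ f) (hH : ContDiff ℝ ∞ H)
    (hc : ContDiff ℝ ∞ c) : ContDiff ℝ ∞ (modelMetricAt f H c) :=
  ((contDiff_smul_const (hH.comp planeProj.contDiff) _).add
    (contDiff_smul_const (contDiff_exponent hf hc).exp _)).add contDiff_const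

theorem contDiff_modelFormAt (hf : ContDiff ℝ ∞ f) (hc : ContDiff ℝ ∞ c) :
    ContDiff ℝ ∞ (modelFormAt f c) :=
  (contDiff_exponent hf hc).exp.smul contDiff_const

theorem modelMetricAt_symm (p v w : E3) :
    modelMetricAt f H c p v w = modelMetricAt f H c p w v := by
  rw [modelMetricAt_apply, modelMetricAt_apply]
  ring

theorem modelMetricAt_one (p w : E3) :
    modelMetricAt f H c p (stdVec 1) w = modelFormAt f c p w := by
  rw [modelMetricAt_apply, modelFormAt_apply]
  simp [stdVec]

/-- The inverse of the metric `H dx_u ⊗ dx_u + e^{2 ∫ f dz + c} dx_u ⊙ dx_v + dz ⊗ dz`. -/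
noncomputable def modelInverse (f H : ℝ × ℝ → ℝ) (c : ℝ → ℝ) (p : E3) : (E3 →L[ℝ] ℝ) →L[ℝ] E3 :=
  let ev := fun i => ContinuousLinearMap.apply ℝ ℝ (stdVec i)
  let r := Real.exp (-exponent f c p)
  (r • ev 1).smulRight (stdVec 0) +
    (r • ev 0 - (H (p 0, p 2) * r ^ 2) • ev 1).smulRight (stdVec 1) + (ev 2).smulRight (stdVec 2)

theorem modelInverse_apply (p : E3) (α : E3 →L[ℝ] ℝ) :
    modelInverse f H c p α =
      (Real.exp (-exponent f c p) * α (stdVec 1)) • stdVec 0 +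
      (Real.exp (-exponent f c p) * α (stdVec 0) -
        H (p 0, p 2) * Real.exp (-exponent f c p) ^ 2 * α (stdVec 1)) • stdVec 1 +
      α (stdVec 2) • stdVec 2 := rfl

theorem modelMetricAt_modelInverse (p : E3) (α : E3 →L[ℝ] ℝ) (w : E3) :
    modelMetricAt f H c p (modelInverse f H c p α) w = α w := by
  have hr : Real.exp (exponent f c p) * Real.exp (-exponent f c p) = 1 := by
    rw [← Real.exp_add, add_neg_cancel, Real.exp_zero]
  conv_rhs => rw [← sum_stdVec w]
  rw [modelMetricAt_apply, modelInverse_apply]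
  simp [stdVec]
  generalize Real.exp (-exponent f c p) = r at *
  linear_combination (α (EuclideanSpace.single 1 1) * w 1 + (α (EuclideanSpace.single 0 1) -
    H (p 0, p 2) * r * α (EuclideanSpace.single 1 1)) * w 0) * hr

/-- A global orthonormal frame of the metric
`H dx_u ⊗ dx_u + e^{2 ∫ f dz + c} dx_u ⊙ dx_v + dz ⊗ dz`. -/
noncomputable def modelFrame (f H : ℝ × ℝ → ℝ) (c : ℝ → ℝ) (i : Fin 3) (p : E3) : E3 :=
  -- `n` is a null vector with `g(n, e₁) = 1/2`, where `e₁` is null as well; hence `n - e₁` and `n +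
  -- e₁` are orthogonal with norms `-1` and `1`.
  let n := (Real.exp (-exponent f c p) / 2) •
    (stdVec 0 - (H (p 0, p 2) * Real.exp (-exponent f c p) / 2) • stdVec 1)
  ![n - stdVec 1, n + stdVec 1, stdVec 2] i

theorem contDiff_modelFrame (hf : ContDiff ℝ ∞ f) (hH : ContDiff ℝ ∞ H) (hc : ContDiff ℝ ∞ c)
    (i : Fin 3) : ContDiff ℝ ∞ (modelFrame f H c i) := by
  have hr : ContDiff ℝ ∞ fun p => Real.exp (-exponent f c p) := (contDiff_exponent hf hc).neg.exp
  have hH' : ContDiff ℝ ∞ fun p : E3 => H (p 0, p 2) := hH.comp planeProj.contDiff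
  have hn := (hr.div_const 2).smul (contDiff_const.sub
    (((hH'.mul hr).div_const 2).smul (contDiff_const (c := stdVec 1))) (f := fun _ => stdVec 0))
  fin_cases i
  · exact hn.sub contDiff_const
  · exact hn.add contDiff_const
  · exact contDiff_const

theorem modelMetricAt_modelFrame (p : E3) (a b : Fin 3) :
    modelMetricAt f H c p (modelFrame f H c a p) (modelFrame f H c b p) = minkowski a b := by
  have hr : Real.exp (exponent f c p) * Real.exp (-exponent f c p) = 1 := by
    rw [← Real.exp_add, add_neg_cancel, Real.exp_zero]
  rw [modelMetricAt_apply]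
  fin_cases a <;> fin_cases b <;> simp [modelFrame, stdVec, minkowski]
  · linear_combination (-(H (p 0, p 2) * Real.exp (-exponent f c p) ^ 2 / 4) - 1) * hr
  · linear_combination -(H (p 0, p 2) * Real.exp (-exponent f c p) ^ 2 / 4) * hr
  · linear_combination -(H (p 0, p 2) * Real.exp (-exponent f c p) ^ 2 / 4) * hr
  · linear_combination (-(H (p 0, p 2) * Real.exp (-exponent f c p) ^ 2 / 4) + 1) * hr

theorem modelVolumeAt_apply (p : E3) (v : Fin 3 → E3) :
    modelVolumeAt f c p v =
      Real.exp (exponent f c p) * (Matrix.of fun i j => v j i).det := by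
  rw [modelVolumeAt, AlternatingMap.smul_apply, Module.Basis.det_apply, smul_eq_mul]
  rfl

theorem modelVolumeAt_modelFrame (p : E3) :
    modelVolumeAt f c p (fun i => modelFrame f H c i p) = 1 := by
  have hr : Real.exp (exponent f c p) * Real.exp (-exponent f c p) = 1 := by
    rw [← Real.exp_add, add_neg_cancel, Real.exp_zero]
  rw [modelVolumeAt_apply, Matrix.det_fin_three]
  simp [modelFrame, stdVec]
  linear_combination hr

theorem spinCover_one : spinCover 1 = 1 := by
  ext a b
  fin_cases a <;> fin_cases b <;> simp [spinCover, symBasis, Matrix.trace_fin_two] <;> norm_num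

/-- The frame is global, so the spin structure can have trivial transition functions. -/
theorem isStronglySpinLorentz_model (hf : ContDiff ℝ ∞ f) (hH : ContDiff ℝ ∞ H)
    (hc : ContDiff ℝ ∞ c) :
    IsStronglySpinLorentz (modelMetric f H c) (modelVolume f c) := by
  refine ⟨⟨fun p v w => modelMetricAt_symm p v w, fun p => ?_,
    contMDiff_of_contDiff (contDiff_modelMetricAt hf hH hc)⟩, ⟨?_⟩⟩
  · obtain ⟨b, hb⟩ := exists_basis_of_orthonormal (g := modelMetric f H c) (x := p)
      (e := fun i => modelFrame f H c i p) (modelMetricAt_modelFrame p)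
    exact ⟨b, by rw [hb]; exact modelMetricAt_modelFrame p⟩
  · exact
    { U := fun _ => univ
      isOpen_U := fun _ => isOpen_univ
      mem_U := fun _ => mem_univ _
      e := fun _ a p => modelFrame f H c a p
      smooth_e := fun _ a => smoothVFieldOn_univ (contDiff_modelFrame hf hH hc a)
      orthonormal := fun _ p _ => modelMetricAt_modelFrame p
      oriented := fun _ p _ => modelVolumeAt_modelFrame p
      s := fun _ _ _ => 1
      continuous_s := fun _ _ => continuousOn_const
      transition := fun _ _ p _ b => by
        rw [spinCover_one, Finset.sum_eq_single b]
        · exact (one_smul ℝ _).symm.trans (congrArg (· • _) (Matrix.one_apply_eq b).symm)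
        · intro a _ hab
          rw [Matrix.one_apply_ne hab]
          exact zero_smul ℝ _
        · exact fun h => absurd (Finset.mem_univ b) h
      cocycle := fun _ _ _ _ _ => mul_one 1 }

theorem sharp_modelForm (p : E3) :
    sharp (modelMetric f H c) p (modelForm f c p) = stdVec 1 := by
  have hspec := sharp_spec (g := modelMetric f H c) (x := p)
    (e := fun i => modelFrame f H c i p) (modelMetricAt_modelFrame p) (modelForm f c p)
  have h1 : ∀ U : E3, (∀ w, modelMetricAt f H c p U w = modelFormAt f c p w) → U = stdVec 1 := by
    intro U hU
    have key : ∀ w : E3, modelMetricAt f H c p (U - stdVec 1) w = 0 := by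
      intro w
      rw [map_sub, sub_apply, hU, modelMetricAt_one, sub_self]
    have hE := (Real.exp_pos (exponent f c p)).ne'
    have k0 := key (stdVec 0)
    have k1 := key (stdVec 1)
    have k2 := key (stdVec 2)
    rw [modelMetricAt_apply] at k0 k1 k2
    simp [stdVec] at k0 k1 k2
    rw [k1] at k0
    simp at k0
    rw [← sum_stdVec U, k1, k2, sub_eq_zero.1 k0]
    simp
  exact h1 _ hspec

theorem isIsotropic_model : IsIsotropic (modelMetric f H c) (modelForm f c) := by
  intro p
  constructor
  · intro h
    have h1 : modelFormAt f c p (stdVec 0) = 0 := DFunLike.congr_fun h (stdVec 0)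
    rw [modelFormAt_apply] at h1
    simp [stdVec] at h1
  · refine (congrArg (modelForm f c p) (sharp_modelForm p)).trans ?_
    change modelFormAt f c p (stdVec 1) = 0
    rw [modelFormAt_apply]
    simp [stdVec]

/-- The `x_u`-derivative `κ` stays unspecified: its contribution `κ v₀ w₀` to the derivative of `u`
is symmetric and cancels in `du`. -/
theorem fderiv_exponent (hf : ContDiff ℝ ∞ f) (hc : ContDiff ℝ ∞ c) (p : E3) :
    ∃ κ : ℝ, ∀ v, fderiv ℝ (exponent f c) p v = κ * v 0 + 2 * f (p 0, p 2) * v 2 := by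
  have hk := (((contDiff_integral_param hf).differentiable (by simp) (planeProj p)).hasFDerivAt.comp p
    planeProj.hasFDerivAt)
  have hcd := (hc.differentiable (by simp) (p 0)).hasFDerivAt.comp p (dCoord 0).hasFDerivAt
  have h := ((hk.const_mul 2).add hcd).fderiv
  have he : fderiv ℝ (exponent f c) p = _ := h
  refine ⟨fderiv ℝ (exponent f c) p (stdVec 0), fun v => ?_⟩
  have h1 : fderiv ℝ (exponent f c) p (stdVec 1) = 0 := by
    have h3 : planeProj (stdVec 1) = 0 := by rw [planeProj_apply]; simp [stdVec]
    have h4 : dCoord 0 (stdVec 1) = 0 := by simp [dCoord, stdVec]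
    rw [he]
    simp only [add_apply, smul_apply, ContinuousLinearMap.comp_apply, h3, h4, map_zero, smul_zero,
      add_zero]
  have h2 : fderiv ℝ (exponent f c) p (stdVec 2) = 2 * f (p 0, p 2) := by
    have h3 : planeProj (stdVec 2) = (0, 1) := by rw [planeProj_apply]; simp [stdVec]
    have h4 : dCoord 0 (stdVec 2) = 0 := by simp [dCoord, stdVec]
    rw [he]
    simp only [add_apply, smul_apply, ContinuousLinearMap.comp_apply, h3, h4, map_zero, add_zero,
      fderiv_integral_param hf, smul_eq_mul, planeProj_apply]
  conv_lhs => rw [← sum_stdVec v]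
  simp only [map_add, map_smul, h1, h2, smul_eq_mul]
  ring

theorem fderiv_modelFormAt (hf : ContDiff ℝ ∞ f) (hc : ContDiff ℝ ∞ c) (p : E3) :
    ∃ κ : ℝ, ∀ v w, fderiv ℝ (modelFormAt f c) p v w =
      Real.exp (exponent f c p) * (κ * v 0 + 2 * f (p 0, p 2) * v 2) * w 0 := by
  obtain ⟨κ, hκ⟩ := fderiv_exponent hf hc p
  refine ⟨κ, fun v w => ?_⟩
  have h := ((((contDiff_exponent hf hc).differentiable (by simp) p).hasFDerivAt.exp).smul_const
    (dCoord 0)).fderiv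
  have he : fderiv ℝ (modelFormAt f c) p = _ := h
  rw [he, ← hκ]
  rfl

theorem fderiv_modelMetricAt_one (hf : ContDiff ℝ ∞ f) (hH : ContDiff ℝ ∞ H)
    (hc : ContDiff ℝ ∞ c) (p : E3) : fderiv ℝ (modelMetricAt f H c) p (stdVec 1) = 0 := by
  have hd := ((contDiff_modelMetricAt hf hH hc).differentiable (by simp) p)
  rw [← hd.lineDeriv_eq_fderiv, lineDeriv]
  have h : (fun t : ℝ => modelMetricAt f H c (p + t • stdVec 1)) =
      fun _ => modelMetricAt f H c p := by
    ext1 t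
    simp [modelMetricAt, exponent, stdVec]
  rw [h, deriv_const]

/-- Holds because `g(e₁, ·) = u` at every point, with `e₁` constant. -/
theorem fderiv_modelMetricAt_right_one (hf : ContDiff ℝ ∞ f) (hH : ContDiff ℝ ∞ H)
    (hc : ContDiff ℝ ∞ c) (p v w : E3) :
    fderiv ℝ (modelMetricAt f H c) p v w (stdVec 1) = fderiv ℝ (modelFormAt f c) p v w := by
  have hd := contDiff_modelMetricAt hf hH hc
  rw [fderiv_bilin_symm modelMetricAt_symm (hd.differentiable (by simp))]
  have h := ((hd.differentiable (by simp) p).hasFDerivAt.clm_apply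
    (hasFDerivAt_const (stdVec 1) p)).fderiv
  have h1 : (fun y => modelMetricAt f H c y (stdVec 1)) = modelFormAt f c := by
    ext y w
    exact modelMetricAt_one y w
  rw [h1] at h
  rw [h]
  simp

theorem isSkewTorsion_model (hf : ContDiff ℝ ∞ f) (hH : ContDiff ℝ ∞ H) (hc : ContDiff ℝ ∞ c) :
    IsSkewTorsion (modelMetric f H c) (modelVolume f c) (modelForm f c)
      (fun p : E3 => f (p 0, p 2)) := by
  have hg := (contDiff_modelMetricAt hf hH hc).differentiable (by simp)
  refine ⟨isStronglySpinLorentz_model hf hH hc, smoothOneForm_of_contDiff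
    (contDiff_modelFormAt hf hc), isIsotropic_model,
    (hf.comp planeProj.contDiff).contMDiff, flatLeviCivita (modelMetricAt f H c)
      (modelInverse f H c), isLeviCivita_flatLeviCivita modelMetricAt_symm hg
      modelMetricAt_modelInverse, ?_⟩
  intro p Y hY v
  have hY' := (differentiableAt_of_mdifferentiableAt hY).hasFDerivAt
  have hu := ((contDiff_modelFormAt hf hc).differentiable (by simp) p).hasFDerivAt
  obtain ⟨κ, hκ⟩ := fderiv_modelFormAt hf hc p
  have h1 := DFunLike.congr_fun ((mvfderiv_eq_fderiv _ p).trans (hu.clm_apply hY').fderiv) v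
  -- Pairing the Christoffel term with `u = g(e₁, ·)` gives half of `∂_v u(y) + ∂_y u(v) - ∂_{e₁}
  -- g(y, v)`. The last term is zero, leaving `∇u = du / 2`, which is compared with the determinant
  -- defining `f *u`.
  have key : ∀ y a v : E3, (modelFormAt f c p a + fderiv ℝ (modelFormAt f c) p v y) -
      modelFormAt f c p (a + modelInverse f H c p (christoffel (modelMetricAt f H c) p y v)) =
      f (p 0, p 2) * modelVolumeAt f c p ![stdVec 1, v, y] := by
    intro y a v
    rw [map_add, ← modelMetricAt_one (H := H) p (modelInverse f H c p _), modelMetricAt_symm,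
      modelMetricAt_modelInverse, christoffel_apply, fderiv_modelMetricAt_right_one hf hH hc,
      fderiv_modelMetricAt_right_one hf hH hc, fderiv_modelMetricAt_one hf hH hc, hκ, hκ,
      modelVolumeAt_apply, Matrix.det_fin_three]
    simp [stdVec]
    ring
  have h2 : hodge (modelMetric f H c) (modelVolume f c) (modelForm f c) p v (Y p) =
      modelVolumeAt f c p ![stdVec 1, v, Y p] :=
    congrArg (fun a : E3 => modelVolumeAt f c p ![a, v, Y p]) (sharp_modelForm p)
  rw [h2]
  refine Eq.trans ?_ (key (Y p) (fderiv ℝ (Y : E3 → E3) p v) v)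
  exact congrArg (· - modelFormAt f c p (flatCovDeriv (modelMetricAt f H c) (modelInverse f H c)
    Y p v)) h1

/-- `H` is the component `g_uu`. The component `g_uv` gives the exponent, in which the integral of
the common `f` cancels. -/
theorem eq_of_modelMetric_eq {H' : ℝ × ℝ → ℝ} {c' : ℝ → ℝ} {p : E3}
    (h : modelMetric f H c p = modelMetric f H' c' p) :
    H (p 0, p 2) = H' (p 0, p 2) ∧ c (p 0) = c' (p 0) := by
  have h1 : ∀ a b, modelMetricAt f H c p a b = modelMetricAt f H' c' p a b := fun a b =>
    DFunLike.congr_fun (DFunLike.congr_fun h a) b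
  have h00 := h1 (stdVec 0) (stdVec 0)
  have h01 := h1 (stdVec 0) (stdVec 1)
  rw [modelMetricAt_apply, modelMetricAt_apply] at h00 h01
  simp [stdVec, exponent] at h00 h01
  exact ⟨h00, h01⟩

end ModelGeometry

end SkewTorsion

theorem mainTheorem8 :
    -- local normal form
    (∀ (M : Type*) [TopologicalSpace M] [T2Space M] [SecondCountableTopology M]
        [ChartedSpace SkewTorsion.E3 M] [IsManifold (𝓡 3) ∞ M]
        (g : SkewTorsion.BilinField M) (ν : SkewTorsion.ThreeForm M)
        (u : SkewTorsion.OneForm M) (f : M → ℝ),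
        SkewTorsion.IsSkewTorsion g ν u f →
        ∀ m : M, ∃ φ ∈ IsManifold.maximalAtlas (𝓡 3) ∞ M, m ∈ φ.source ∧
          ∃ (f' H : ℝ × ℝ → ℝ) (c : ℝ → ℝ),
            ContDiff ℝ ∞ f' ∧ ContDiff ℝ ∞ H ∧ ContDiff ℝ ∞ c ∧
            ∀ x ∈ φ.source,
              f x = f' (φ x 0, φ x 2) ∧
              (∀ v w : TangentSpace (𝓡 3) x,
                g x v w = SkewTorsion.modelMetric f' H c (φ x)
                  (mfderiv (𝓡 3) (𝓡 3) φ x v) (mfderiv (𝓡 3) (𝓡 3) φ x w)) ∧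
              (∀ v : TangentSpace (𝓡 3) x,
                u x v = SkewTorsion.modelForm f' c (φ x) (mfderiv (𝓡 3) (𝓡 3) φ x v))) ∧
    -- every choice of the parameters is realized
    (∀ (f H : ℝ × ℝ → ℝ) (c : ℝ → ℝ),
        ContDiff ℝ ∞ f → ContDiff ℝ ∞ H → ContDiff ℝ ∞ c →
        SkewTorsion.IsSkewTorsion (SkewTorsion.modelMetric f H c) (SkewTorsion.modelVolume f c)
          (SkewTorsion.modelForm f c) (fun p : SkewTorsion.E3 => f (p 0, p 2))) ∧
    -- for a given torsion function, the metric determines the parameters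
    (∀ (f H H' : ℝ × ℝ → ℝ) (c c' : ℝ → ℝ) (p : SkewTorsion.E3),
        SkewTorsion.modelMetric f H c p = SkewTorsion.modelMetric f H' c' p →
          H (p 0, p 2) = H' (p 0, p 2) ∧ c (p 0) = c' (p 0)) := by
  refine ⟨?_, ?_, ?_⟩
  · intro M _ _ _ _ _ g ν u f hst m
    exact hst.exists_normal_form m
  · intro f H c hf hH hc
    exact SkewTorsion.isSkewTorsion_model hf hH hc
  · intro f H H' c c' p h
    exact SkewTorsion.eq_of_modelMetric_eq h
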